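/- Let $d\ge 1$, $N\ge 2$, and let $\Omega\subset\mathbb R^d$ be a bounded open convex set. Let $\{\varphi_i\}_{i=1}^N$ be a conformal iterated function system on $\Omega$. This means that each $\varphi_i\colon\Omega\to\mathbb R^d$ is injective and $C^1$, its differential satisfies $|\varphi_i'(x)y|=|\varphi_i'(x)||y|\neq 0$ for all $x\in\Omega$ and $y\in\mathbb R^d\setminus\{0\}$, there are $\alpha,c>0$ with $|\varphi_i'(x)-\varphi_i'(y)|\le c|x-y|^{\alpha}$ for all $x,y\in\Omega$, and moreover $\overline{\varphi_i(\Omega)}\subset\Omega$ and $\|\varphi_i'\|:=\sup_{x\in\Omega}|\varphi_i'(x)|<1$. Let $F\subset\Omega$ be the associated self-conformal set, i.e. the unique non-empty compact set $F\subset\Omega$ with $F=\bigcup_{i=1}^N\varphi_i(F)$. Let $\Sigma_*$ be the set of all finite words over $\{1,\dots,N\}$, including the empty word $\varnothing$. For $\mathtt i=i_1\cdots i_n\in\Sigma_*$ write $\varphi_{\mathtt i}=\varphi_{i_1}\circ\cdots\circ\varphi_{i_n}$ (with $\varphi_\varnothing=\mathrm{id}$) and $\|\varphi_{\mathtt i}'\|=\sup_{x\in\Omega}|\varphi_{\mathtt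 i}'(x)|$, and for $\mathtt i\neq\varnothing$ let $\mathtt i^-=i_1\cdots i_{n-1}$. Let $B(x,r)$ be the closed ball with center $x$ and radius $r$. For $x\in\mathbb R^d$ and $r>0$ define $$\Phi(x,r)=\{\varphi_{\mathtt i}|_F:\ \mathtt i\in\Sigma_*\setminus\{\varnothing\},\ \operatorname{diam}(\varphi_{\mathtt i}(F))\le r<\operatorname{diam}(\varphi_{\mathtt i^-}(F))\text{ and }\varphi_{\mathtt i}(F)\cap B(x,r)\neq\emptyset\}.$$ Suppose that $F$ contains at least two points. Then $F$ satisfies the weak separation condition $$\sup\{\#\Phi(x,r):x\in F\text{ and }r>0\}<\infty$$ if and only if it satisfies the identity limit criterion $$\inf\Bigl\{\|\varphi_{\mathtt i}'\|^{-1}\sup_{x\in F}|\varphi_{\mathtt i}(x)-\varphi_{\mathtt j}(x)|:\ \mathtt i,\mathtt j\in\Sigma_*\text{ such that }\varphi_{\mathtt i}|_F\neq\varphi_{\mathtt j}|_F\Bigr\}>0.$$ -/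

import Mathlib

open Set

noncomputable section

namespace SelfConformal

/-- `E d` is `ℝ^d` with its Euclidean norm. -/
abbrev E (d : ℕ) : Type := EuclideanSpace ℝ (Fin d)

/-- `‖g'‖ = sup_{x ∈ Ω} |g'(x)|`, where `|g'(x)|` is the operator norm of the differential. -/
def derivNorm {d : ℕ} (Ω : Set (E d)) (g : E d → E d) : ℝ :=
  ⨆ x : Ω, ‖fderiv ℝ g (x : E d)‖

/-- `g` is conformal on the (open) set `Ω`: it is `C^1`, each differential is a similarity, and the
differential is Hölder continuous on `Ω`. Only the values of `g` on `Ω` matter when `Ω` is open. -/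
structure IsConformalOn {d : ℕ} (Ω : Set (E d)) (g : E d → E d) : Prop where
  contDiffOn : ContDiffOn ℝ 1 g Ω
  similarity : ∀ x ∈ Ω, ∀ y : E d, y ≠ 0 →
    ‖fderiv ℝ g x y‖ = ‖fderiv ℝ g x‖ * ‖y‖ ∧ ‖fderiv ℝ g x y‖ ≠ 0
  holder : ∃ α > (0 : ℝ), ∃ c > (0 : ℝ), ∀ x ∈ Ω, ∀ y ∈ Ω,
    ‖fderiv ℝ g x - fderiv ℝ g y‖ ≤ c * ‖x - y‖ ^ α

/-- A conformal iterated function system of `N ≥ 2` maps on a bounded open convex set `Ω ⊆ ℝ^d`.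
The maps are total functions for convenience; only their restrictions to `Ω` are used. -/
structure ConformalIFS (d N : ℕ) where
  /-- the domain -/
  Ω : Set (E d)
  /-- the maps -/
  φ : Fin N → E d → E d
  two_le : 2 ≤ N
  isOpen : IsOpen Ω
  convex : Convex ℝ Ω
  isBounded : Bornology.IsBounded Ω
  injOn : ∀ i, InjOn (φ i) Ω
  conformal : ∀ i, IsConformalOn Ω (φ i)
  closure_image_subset : ∀ i, closure (φ i '' Ω) ⊆ Ω
  /-- the supremum defining `‖φ_i'‖` is finite -/
  bddAbove : ∀ i, BddAbove (range fun x : Ω => ‖fderiv ℝ (φ i) (x : E d)‖)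
  derivNorm_lt_one : ∀ i, derivNorm Ω (φ i) < 1

namespace ConformalIFS

variable {d N : ℕ}

/-- `φ_w = φ_{w_1} ∘ ⋯ ∘ φ_{w_n}` for a finite word `w`; the empty word gives the identity. -/
def wordMap (S : ConformalIFS d N) : List (Fin N) → E d → E d
  | [] => id
  | i :: w => S.φ i ∘ S.wordMap w

/-- `F` is the self-conformal set of `S`: the non-empty compact subset of `Ω` with
`F = ⋃ i, φ_i(F)`. -/
structure IsSelfConformalSet (S : ConformalIFS d N) (F : Set (E d)) : Prop where
  nonempty : F.Nonempty
  isCompact : IsCompact F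
  subset : F ⊆ S.Ω
  invariant : F = ⋃ i, S.φ i '' F

/-- `Φ(x,r)`, the set of the restrictions `φ_w|_F` (as functions on `F`) over the non-empty words
`w` with `diam φ_w(F) ≤ r < diam φ_{w^-}(F)` and `φ_w(F) ∩ B(x,r) ≠ ∅`. Here `w^-` is `w` without
its last letter and `B(x,r)` is the closed ball. -/
def Phi (S : ConformalIFS d N) (F : Set (E d)) (x : E d) (r : ℝ) : Set (F → E d) :=
  {g | ∃ w : List (Fin N), w ≠ [] ∧
    Metric.diam (S.wordMap w '' F) ≤ r ∧ r < Metric.diam (S.wordMap w.dropLast '' F) ∧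
    (S.wordMap w '' F ∩ Metric.closedBall x r).Nonempty ∧
    g = F.domRestrict (S.wordMap w)}

/-- The weak separation condition: `sup {#Φ(x,r) : x ∈ F, r > 0} < ∞`. -/
def WeakSeparation (S : ConformalIFS d N) (F : Set (E d)) : Prop :=
  ∃ M : ℕ, ∀ x ∈ F, ∀ r : ℝ, 0 < r → (S.Phi F x r).encard ≤ M

/-- The identity limit criterion: the infimum of `‖φ_u'‖⁻¹ sup_{x ∈ F} |φ_u(x) - φ_v(x)|` over all
finite words `u, v` with `φ_u|_F ≠ φ_v|_F` is positive, i.e. there is a positive lower bound. -/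
def IdentityLimitCriterion (S : ConformalIFS d N) (F : Set (E d)) : Prop :=
  ∃ c : ℝ, 0 < c ∧ ∀ u v : List (Fin N),
    F.domRestrict (S.wordMap u) ≠ F.domRestrict (S.wordMap v) →
      c ≤ (derivNorm S.Ω (S.wordMap u))⁻¹ * ⨆ x : F, ‖S.wordMap u x - S.wordMap v x‖

end ConformalIFS

end SelfConformal

end

noncomputable section
namespace SelfConformal
namespace ConformalIFS
variable {d N : ℕ}

/-! Everything rests on bounded distortion. Differentials of word maps are similarities, so their
norms multiply, and Hölder continuity along contracted orbits gives a geometric series that controls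
the relative variation of `φ_w'` uniformly in `w`. Hence `‖φ_w'‖` is multiplicative up to a
constant, `φ_w` scales distances on `F` by a factor comparable to `‖φ_w'‖`, and so does the diameter
of `φ_w(F)`.

The criterion implies weak separation by total boundedness. Rescaled by `1/r`, the maps in `Φ(x,r)`
are equi-Lipschitz with values in a fixed ball. Two of them with the same code on finite nets are so
close that the criterion makes them equal.

Conversely, let the criterion fail, so that some `φ_u`, `φ_v` have tiny positive relative distance
`δ`. By compactness (`exists_lipschitz_of_small`) their difference also has a tiny relative
Lipschitz constant. It therefore vanishes nowhere on a cylinder `φ_w(F)` much larger than `δ`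
(`exists_separating_words`). From a cluster `T` of words with base word `g₀`, whose maps differ
pairwise at every point of `F`, one forms the larger cluster of all `uwg`, `g ∈ T`, together with
`vwg₀` (`exists_cluster`). Suffixes of bounded length put every member of a cluster into a single
`Φ(x,r)`. Since the maps differ at every point, members with the same suffix stay distinct, so `#Φ`
is unbounded. -/

theorem wordMap_append (S : ConformalIFS d N) (u v : List (Fin N)) :
    S.wordMap (u ++ v) = S.wordMap u ∘ S.wordMap v := by
  induction u with
  | nil => rfl
  | cons i u ih => simp only [List.cons_append, wordMap, ih, Function.comp_assoc]

theorem wordMap_append_apply (S : ConformalIFS d N) (u v : List (Fin N)) (x : E d) :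
    S.wordMap (u ++ v) x = S.wordMap u (S.wordMap v x) := by
  rw [wordMap_append]; rfl

theorem mapsTo_φ (S : ConformalIFS d N) (i : Fin N) : MapsTo (S.φ i) S.Ω S.Ω := fun _ hx =>
  S.closure_image_subset i (subset_closure (mem_image_of_mem _ hx))

theorem mapsTo_wordMap (S : ConformalIFS d N) (w : List (Fin N)) :
    MapsTo (S.wordMap w) S.Ω S.Ω := by
  induction w with
  | nil => exact fun _ hx => hx
  | cons i w ih => exact (S.mapsTo_φ i).comp ih

theorem injOn_wordMap (S : ConformalIFS d N) (w : List (Fin N)) : InjOn (S.wordMap w) S.Ω := by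
  induction w with
  | nil => exact injOn_id _
  | cons i w ih => exact (S.injOn i).comp ih (S.mapsTo_wordMap w)

theorem differentiableAt_φ (S : ConformalIFS d N) (i : Fin N) {x : E d} (hx : x ∈ S.Ω) :
    DifferentiableAt ℝ (S.φ i) x :=
  ((S.conformal i).contDiffOn.differentiableOn one_ne_zero).differentiableAt
    (S.isOpen.mem_nhds hx)

theorem differentiableAt_wordMap (S : ConformalIFS d N) (w : List (Fin N)) {x : E d}
    (hx : x ∈ S.Ω) : DifferentiableAt ℝ (S.wordMap w) x := by
  induction w with
  | nil => exact differentiableAt_id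
  | cons i w ih => exact (S.differentiableAt_φ i (S.mapsTo_wordMap w hx)).comp x ih

theorem continuousOn_wordMap (S : ConformalIFS d N) (w : List (Fin N)) :
    ContinuousOn (S.wordMap w) S.Ω := fun _ hx =>
  (S.differentiableAt_wordMap w hx).continuousAt.continuousWithinAt

theorem fderiv_cons (S : ConformalIFS d N) (i : Fin N) (v : List (Fin N)) {x : E d}
    (hx : x ∈ S.Ω) : fderiv ℝ (S.wordMap (i :: v)) x =
      (fderiv ℝ (S.φ i) (S.wordMap v x)).comp (fderiv ℝ (S.wordMap v) x) :=
  fderiv_comp x (S.differentiableAt_φ i (S.mapsTo_wordMap v hx)) (S.differentiableAt_wordMap v hx)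

theorem fderiv_append (S : ConformalIFS d N) (u v : List (Fin N)) {x : E d}
    (hx : x ∈ S.Ω) : fderiv ℝ (S.wordMap (u ++ v)) x =
      (fderiv ℝ (S.wordMap u) (S.wordMap v x)).comp (fderiv ℝ (S.wordMap v) x) := by
  rw [wordMap_append]
  exact fderiv_comp x (S.differentiableAt_wordMap u (S.mapsTo_wordMap v hx))
    (S.differentiableAt_wordMap v hx)

/-! ### Conformality and norms of words -/

theorem norm_fderiv_φ_apply (S : ConformalIFS d N) (i : Fin N) {x : E d} (hx : x ∈ S.Ω)
    (y : E d) : ‖fderiv ℝ (S.φ i) x y‖ = ‖fderiv ℝ (S.φ i) x‖ * ‖y‖ := by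
  rcases eq_or_ne y 0 with rfl | hy
  · simp
  · exact ((S.conformal i).similarity x hx y hy).1

theorem norm_fderiv_φ_pos [Nontrivial (E d)] (S : ConformalIFS d N) (i : Fin N) {x : E d}
    (hx : x ∈ S.Ω) : 0 < ‖fderiv ℝ (S.φ i) x‖ := by
  obtain ⟨y, hy⟩ := exists_ne (0 : E d)
  have h := (S.conformal i).similarity x hx y hy
  rw [h.1] at h
  exact (norm_nonneg _).lt_of_ne' (left_ne_zero_of_mul h.2)

/-- A composition of similarities is a similarity whose ratio is the product of the ratios.
Nontriviality of the space gives the empty word ratio one. -/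
theorem norm_fderiv_wordMap_apply [Nontrivial (E d)] (S : ConformalIFS d N) (w : List (Fin N))
    {x : E d} (hx : x ∈ S.Ω) (y : E d) :
    ‖fderiv ℝ (S.wordMap w) x y‖ = ‖fderiv ℝ (S.wordMap w) x‖ * ‖y‖ := by
  induction w generalizing y with
  | nil => simp [wordMap, ContinuousLinearMap.norm_id]
  | cons i w ih =>
    have h1 : ∀ y, ‖fderiv ℝ (S.wordMap (i :: w)) x y‖ =
        ‖fderiv ℝ (S.φ i) (S.wordMap w x)‖ * ‖fderiv ℝ (S.wordMap w) x‖ * ‖y‖ := fun y => by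
      rw [S.fderiv_cons i w hx, ContinuousLinearMap.comp_apply,
        S.norm_fderiv_φ_apply i (S.mapsTo_wordMap w hx), ih, mul_assoc]
    have h2 : ‖fderiv ℝ (S.wordMap (i :: w)) x‖ =
        ‖fderiv ℝ (S.φ i) (S.wordMap w x)‖ * ‖fderiv ℝ (S.wordMap w) x‖ :=
      ContinuousLinearMap.homothety_norm _ h1
    rw [h1, h2]

theorem norm_fderiv_cons [Nontrivial (E d)] (S : ConformalIFS d N) (i : Fin N)
    (w : List (Fin N)) {x : E d} (hx : x ∈ S.Ω) :
    ‖fderiv ℝ (S.wordMap (i :: w)) x‖ =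
      ‖fderiv ℝ (S.φ i) (S.wordMap w x)‖ * ‖fderiv ℝ (S.wordMap w) x‖ := by
  refine ContinuousLinearMap.homothety_norm _ fun y => ?_
  rw [S.fderiv_cons i w hx, ContinuousLinearMap.comp_apply,
    S.norm_fderiv_φ_apply i (S.mapsTo_wordMap w hx), S.norm_fderiv_wordMap_apply w hx, mul_assoc]

theorem norm_fderiv_append [Nontrivial (E d)] (S : ConformalIFS d N) (u v : List (Fin N))
    {x : E d} (hx : x ∈ S.Ω) :
    ‖fderiv ℝ (S.wordMap (u ++ v)) x‖ =
      ‖fderiv ℝ (S.wordMap u) (S.wordMap v x)‖ * ‖fderiv ℝ (S.wordMap v) x‖ := by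
  refine ContinuousLinearMap.homothety_norm _ fun y => ?_
  rw [S.fderiv_append u v hx, ContinuousLinearMap.comp_apply,
    S.norm_fderiv_wordMap_apply u (S.mapsTo_wordMap v hx), S.norm_fderiv_wordMap_apply v hx,
    mul_assoc]

theorem norm_fderiv_wordMap_pos [Nontrivial (E d)] (S : ConformalIFS d N) (w : List (Fin N))
    {x : E d} (hx : x ∈ S.Ω) : 0 < ‖fderiv ℝ (S.wordMap w) x‖ := by
  induction w with
  | nil => simp [wordMap, ContinuousLinearMap.norm_id]
  | cons i w ih =>
    rw [S.norm_fderiv_cons i w hx]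
    exact mul_pos (S.norm_fderiv_φ_pos i (S.mapsTo_wordMap w hx)) ih

/-- A common contraction ratio of the maps of the system. -/
theorem exists_contraction (S : ConformalIFS d N) :
    ∃ l : ℝ, 0 < l ∧ l < 1 ∧ ∀ i, ∀ x ∈ S.Ω, ‖fderiv ℝ (S.φ i) x‖ ≤ l := by
  have hN : Nonempty (Fin N) := ⟨⟨0, by have := S.two_le; omega⟩⟩
  obtain ⟨i₀, hi₀⟩ := Finite.exists_max fun i => derivNorm S.Ω (S.φ i)
  -- The maximum with `1/2` keeps the ratio positive when `Ω` is empty or `d = 0`, where all norms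
  -- are zero.
  refine ⟨max (derivNorm S.Ω (S.φ i₀)) (1 / 2), by positivity,
    max_lt (S.derivNorm_lt_one i₀) (by norm_num), fun i x hx => ?_⟩
  exact ((le_ciSup (S.bddAbove i) ⟨x, hx⟩).trans (hi₀ i)).trans (le_max_left _ _)

theorem norm_fderiv_wordMap_le_pow [Nontrivial (E d)] (S : ConformalIFS d N) {l : ℝ} (hl0 : 0 < l)
    (hl : ∀ i, ∀ x ∈ S.Ω, ‖fderiv ℝ (S.φ i) x‖ ≤ l) (w : List (Fin N)) {x : E d}
    (hx : x ∈ S.Ω) : ‖fderiv ℝ (S.wordMap w) x‖ ≤ l ^ w.length := by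
  induction w with
  | nil => simp [wordMap, ContinuousLinearMap.norm_id]
  | cons i w ih =>
    rw [S.norm_fderiv_cons i w hx, List.length_cons, pow_succ']
    exact mul_le_mul (hl i _ (S.mapsTo_wordMap w hx)) ih (norm_nonneg _) hl0.le

/-- The norm `‖φ_w'‖` of a word. -/
def wordNorm (S : ConformalIFS d N) (w : List (Fin N)) : ℝ := derivNorm S.Ω (S.wordMap w)

theorem norm_fderiv_le_wordNorm [Nontrivial (E d)] (S : ConformalIFS d N) (w : List (Fin N))
    {x : E d} (hx : x ∈ S.Ω) : ‖fderiv ℝ (S.wordMap w) x‖ ≤ S.wordNorm w := by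
  obtain ⟨l, hl0, -, hl⟩ := S.exists_contraction
  have hb : BddAbove (range fun x : S.Ω => ‖fderiv ℝ (S.wordMap w) (x : E d)‖) :=
    ⟨l ^ w.length, by
      rintro _ ⟨y, rfl⟩
      exact S.norm_fderiv_wordMap_le_pow hl0 hl w y.2⟩
  exact le_ciSup hb ⟨x, hx⟩

theorem wordNorm_le (S : ConformalIFS d N) (hΩ : S.Ω.Nonempty) (w : List (Fin N)) {C : ℝ}
    (h : ∀ x ∈ S.Ω, ‖fderiv ℝ (S.wordMap w) x‖ ≤ C) : S.wordNorm w ≤ C := by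
  have := hΩ.to_subtype
  exact ciSup_le fun x => h x x.2

theorem wordNorm_pos [Nontrivial (E d)] (S : ConformalIFS d N) (hΩ : S.Ω.Nonempty)
    (w : List (Fin N)) : 0 < S.wordNorm w :=
  let ⟨_, hx⟩ := hΩ
  (S.norm_fderiv_wordMap_pos w hx).trans_le (S.norm_fderiv_le_wordNorm w hx)

theorem wordNorm_nil [Nontrivial (E d)] (S : ConformalIFS d N) (hΩ : S.Ω.Nonempty) :
    S.wordNorm [] = 1 := by
  have := hΩ.to_subtype
  simp [wordNorm, derivNorm, wordMap, ContinuousLinearMap.norm_id]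

/-- `φ_w` is Lipschitz on `Ω` with constant `‖φ_w'‖`. -/
theorem norm_wordMap_sub_le [Nontrivial (E d)] (S : ConformalIFS d N) (w : List (Fin N))
    {x y : E d} (hx : x ∈ S.Ω) (hy : y ∈ S.Ω) :
    ‖S.wordMap w x - S.wordMap w y‖ ≤ S.wordNorm w * ‖x - y‖ :=
  S.convex.norm_image_sub_le_of_norm_fderiv_le (𝕜 := ℝ)
    (fun _ hz => S.differentiableAt_wordMap w hz) (fun _ hz => S.norm_fderiv_le_wordNorm w hz) hy hx

theorem wordNorm_append_le [Nontrivial (E d)] (S : ConformalIFS d N) (hΩ : S.Ω.Nonempty)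
    (u v : List (Fin N)) : S.wordNorm (u ++ v) ≤ S.wordNorm u * S.wordNorm v := by
  refine S.wordNorm_le hΩ _ fun x hx => ?_
  rw [S.norm_fderiv_append u v hx]
  exact mul_le_mul (S.norm_fderiv_le_wordNorm u (S.mapsTo_wordMap v hx))
    (S.norm_fderiv_le_wordNorm v hx) (norm_nonneg _) (S.wordNorm_pos hΩ u).le

/-- A common Hölder exponent and constant for the differentials of the maps of the system. -/
theorem exists_holder (S : ConformalIFS d N) :
    ∃ α > (0 : ℝ), ∃ c > (0 : ℝ), ∀ i, ∀ x ∈ S.Ω, ∀ y ∈ S.Ω,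
      ‖fderiv ℝ (S.φ i) x - fderiv ℝ (S.φ i) y‖ ≤ c * ‖x - y‖ ^ α := by
  have hN : Nonempty (Fin N) := ⟨⟨0, by have := S.two_le; omega⟩⟩
  choose α hα c hc h using fun i => (S.conformal i).holder
  obtain ⟨i₀, hi₀⟩ := Finite.exists_min α
  obtain ⟨D, hD⟩ := S.isBounded.exists_norm_le
  -- `R` bounds the distances in `Ω`; lowering the exponent from `α i` to the minimal `α i₀` costs a
  -- factor `R ^ (α i - α i₀)`.
  set R : ℝ := max 1 (D + D) with hR
  have hR1 : 1 ≤ R := le_max_left _ _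
  obtain ⟨i₁, hi₁⟩ := Finite.exists_max fun i => c i * R ^ (α i - α i₀)
  refine ⟨α i₀, hα i₀, c i₁ * R ^ (α i₁ - α i₀), mul_pos (hc _) (by positivity),
    fun i x hx y hy => (h i x hx y hy).trans ?_⟩
  have hxy : ‖x - y‖ ≤ R :=
    ((norm_sub_le _ _).trans (add_le_add (hD x hx) (hD y hy))).trans (le_max_right _ _)
  have h1 : ‖x - y‖ ^ α i = ‖x - y‖ ^ (α i - α i₀) * ‖x - y‖ ^ α i₀ := by
    rw [← Real.rpow_add_of_nonneg (norm_nonneg _) (sub_nonneg.2 (hi₀ i)) (hα i₀).le]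
    ring_nf
  have h2 : ‖x - y‖ ^ (α i - α i₀) ≤ R ^ (α i - α i₀) :=
    Real.rpow_le_rpow (norm_nonneg _) hxy (sub_nonneg.2 (hi₀ i))
  rw [h1, ← mul_assoc]
  refine mul_le_mul_of_nonneg_right ?_ (by positivity)
  exact (mul_le_mul_of_nonneg_left h2 (hc i).le).trans (hi₁ i)

section SelfConformalSet
variable {S : ConformalIFS d N} {F : Set (E d)}

theorem IsSelfConformalSet.mapsTo (hF : S.IsSelfConformalSet F) (w : List (Fin N)) :
    MapsTo (S.wordMap w) F F := by
  induction w with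
  | nil => exact fun _ hx => hx
  | cons i w ih =>
    intro x hx
    rw [hF.invariant]
    exact mem_iUnion.2 ⟨i, mem_image_of_mem _ (ih hx)⟩

theorem IsSelfConformalSet.nonempty_domain (hF : S.IsSelfConformalSet F) : S.Ω.Nonempty :=
  hF.nonempty.mono hF.subset

/-- The differentials of the maps of the system are bounded away from zero on the attractor. -/
theorem IsSelfConformalSet.exists_norm_fderiv_ge [Nontrivial (E d)]
    (hF : S.IsSelfConformalSet F) :
    ∃ m > (0 : ℝ), ∀ i, ∀ x ∈ F, m ≤ ‖fderiv ℝ (S.φ i) x‖ := by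
  have hN : Nonempty (Fin N) := ⟨⟨0, by have := S.two_le; omega⟩⟩
  -- Compactness of `F` is essential: on `Ω` the differential may tend to zero at the boundary. This
  -- is why later estimates compare with points of `F`.
  have key : ∀ i, ∃ x ∈ F, IsMinOn (fun x => ‖fderiv ℝ (S.φ i) x‖) F x := fun i =>
    hF.isCompact.exists_isMinOn hF.nonempty
      (((S.conformal i).contDiffOn.continuousOn_fderiv_of_isOpen S.isOpen le_rfl).mono
        hF.subset).norm
  choose x hx hmin using key
  obtain ⟨i₀, hi₀⟩ := Finite.exists_min fun i => ‖fderiv ℝ (S.φ i) (x i)‖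
  exact ⟨_, S.norm_fderiv_φ_pos i₀ (hF.subset (hx i₀)), fun i y hy => (hi₀ i).trans (hmin i hy)⟩

end SelfConformalSet
-- Bounded distortion and its consequences
section Distortion
variable {S : ConformalIFS d N} {F : Set (E d)}

/-- Bounded distortion, with a modulus independent of the word. -/
theorem IsSelfConformalSet.exists_distortion [Nontrivial (E d)] (hF : S.IsSelfConformalSet F) :
    ∃ a > (0 : ℝ), ∃ α > (0 : ℝ), ∀ w : List (Fin N), ∀ y ∈ F, ∀ x ∈ S.Ω,
      ‖fderiv ℝ (S.wordMap w) x - fderiv ℝ (S.wordMap w) y‖ ≤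
        (Real.exp (a * ‖x - y‖ ^ α) - 1) * ‖fderiv ℝ (S.wordMap w) y‖ := by
  obtain ⟨l, hl0, hl1, hl⟩ := S.exists_contraction
  obtain ⟨m, hm0, hm⟩ := hF.exists_norm_fderiv_ge
  obtain ⟨α, hα, c, hc, hH⟩ := S.exists_holder
  have hlα1 : l ^ α < 1 := Real.rpow_lt_one hl0.le hl1 hα
  have hlα0 : 0 < l ^ α := by positivity
  -- `c / m` is a Hölder constant relative to the differential at points of `F`; the other factor
  -- sums the contraction of the orbits.
  refine ⟨c / m * (1 - l ^ α)⁻¹, mul_pos (div_pos hc hm0) (inv_pos.2 (sub_pos.2 hlα1)), α, hα, ?_⟩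
  intro w y hy x hx
  have hyΩ := hF.subset hy
  set t := ‖x - y‖ with ht
  have ht0 : 0 ≤ t := norm_nonneg _
  -- Relative errors `s` and `Q - 1` of two factors combine to `Q * (s + 1) - 1`. The form `exp - 1`
  -- is stable under this because `s + 1 ≤ exp s`.
  have main : ‖fderiv ℝ (S.wordMap w) x - fderiv ℝ (S.wordMap w) y‖ ≤
      (Real.exp (∑ k ∈ Finset.range w.length, c / m * t ^ α * (l ^ α) ^ k) - 1) *
        ‖fderiv ℝ (S.wordMap w) y‖ := by
    induction w with
    | nil => simp [wordMap]
    | cons i w ih =>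
      have hxw := S.mapsTo_wordMap w hx
      have hyw := S.mapsTo_wordMap w hyΩ
      set A := fderiv ℝ (S.φ i) (S.wordMap w x) with hA
      set A' := fderiv ℝ (S.φ i) (S.wordMap w y) with hA'
      set B := fderiv ℝ (S.wordMap w) x with hB
      set B' := fderiv ℝ (S.wordMap w) y with hB'
      set s := c / m * t ^ α * (l ^ α) ^ w.length with hs
      set Q := Real.exp (∑ k ∈ Finset.range w.length, c / m * t ^ α * (l ^ α) ^ k) with hQ
      have hs0 : 0 ≤ s := by positivity
      have hdist : ‖S.wordMap w x - S.wordMap w y‖ ≤ l ^ w.length * t :=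
        S.convex.norm_image_sub_le_of_norm_fderiv_le (𝕜 := ℝ)
          (fun _ hz => S.differentiableAt_wordMap w hz)
          (fun _ hz => S.norm_fderiv_wordMap_le_pow hl0 hl w hz) hyΩ hx
      have hAA : ‖A - A'‖ ≤ s * ‖A'‖ := by
        have hmA : m ≤ ‖A'‖ := hm i _ (hF.mapsTo w hy)
        calc ‖A - A'‖ ≤ c * ‖S.wordMap w x - S.wordMap w y‖ ^ α := hH i _ hxw _ hyw
          _ ≤ c * (l ^ w.length * t) ^ α := by gcongr
          _ = s * m := by
            rw [hs, Real.mul_rpow (by positivity) ht0, ← Real.rpow_natCast, ← Real.rpow_natCast,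
              ← Real.rpow_mul hl0.le, ← Real.rpow_mul hl0.le, mul_comm (w.length : ℝ) α]
            field_simp
          _ ≤ s * ‖A'‖ := by gcongr
      have hBQ : ‖B‖ ≤ Q * ‖B'‖ := by
        have := norm_le_norm_add_norm_sub' B B'
        linarith
      rw [S.fderiv_cons i w hx, S.fderiv_cons i w hyΩ]
      have hnorm : ‖A'.comp B'‖ = ‖A'‖ * ‖B'‖ := by
        rw [← S.fderiv_cons i w hyΩ]
        exact S.norm_fderiv_cons i w hyΩ
      have hsplit : A.comp B - A'.comp B' = (A - A').comp B + A'.comp (B - B') := by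
        ext1 z; simp
      rw [hnorm, hsplit, List.length_cons, Finset.sum_range_succ, Real.exp_add, ← hQ, ← hs]
      calc ‖(A - A').comp B + A'.comp (B - B')‖
          ≤ ‖A - A'‖ * ‖B‖ + ‖A'‖ * ‖B - B'‖ :=
            (norm_add_le _ _).trans (add_le_add (ContinuousLinearMap.opNorm_comp_le _ _)
              (ContinuousLinearMap.opNorm_comp_le _ _))
        _ ≤ (s * ‖A'‖) * (Q * ‖B'‖) + ‖A'‖ * ((Q - 1) * ‖B'‖) := by gcongr
        _ = (Q * (s + 1) - 1) * (‖A'‖ * ‖B'‖) := by ring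
        _ ≤ (Q * Real.exp s - 1) * (‖A'‖ * ‖B'‖) := by
            gcongr
            exact Real.add_one_le_exp s
  refine main.trans ?_
  gcongr
  rw [← Finset.mul_sum, mul_right_comm]
  gcongr
  have hsum := summable_geometric_of_lt_one hlα0.le hlα1
  rw [← tsum_geometric_of_lt_one hlα0.le hlα1]
  exact hsum.sum_le_tsum _ fun _ _ => by positivity

/-- The norm of the differential at a point of the attractor is comparable to `‖φ_w'‖`. -/
theorem IsSelfConformalSet.exists_wordNorm_le [Nontrivial (E d)] (hF : S.IsSelfConformalSet F) :
    ∃ K ≥ (1 : ℝ), ∀ w : List (Fin N), ∀ y ∈ F,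
      S.wordNorm w ≤ K * ‖fderiv ℝ (S.wordMap w) y‖ := by
  obtain ⟨a, ha, α, hα, h⟩ := hF.exists_distortion
  obtain ⟨D, hD⟩ := S.isBounded.exists_norm_le
  obtain ⟨z, hz⟩ := hF.nonempty_domain
  have hD0 : 0 ≤ D := (norm_nonneg _).trans (hD z hz)
  refine ⟨Real.exp (a * (D + D) ^ α), Real.one_le_exp (by positivity), fun w y hy => ?_⟩
  refine S.wordNorm_le hF.nonempty_domain w fun x hx => ?_
  have hxy : ‖x - y‖ ≤ D + D :=
    (norm_sub_le _ _).trans (add_le_add (hD x hx) (hD y (hF.subset hy)))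
  have h1 := h w y hy x hx
  have h2 := norm_le_norm_add_norm_sub' (fderiv ℝ (S.wordMap w) x) (fderiv ℝ (S.wordMap w) y)
  calc ‖fderiv ℝ (S.wordMap w) x‖
      ≤ Real.exp (a * ‖x - y‖ ^ α) * ‖fderiv ℝ (S.wordMap w) y‖ := by linarith
    _ ≤ _ := by gcongr

theorem IsSelfConformalSet.exists_ball_subset (hF : S.IsSelfConformalSet F) :
    ∃ r > (0 : ℝ), ∀ y ∈ F, Metric.ball y r ⊆ S.Ω := by
  obtain ⟨r, hr, h⟩ := hF.isCompact.exists_thickening_subset_open S.isOpen hF.subset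
  exact ⟨r, hr, fun y hy => (Metric.ball_subset_thickening hy r).trans h⟩

/-- Differentials of `φ_w` vary little, relative to their size, on small balls. -/
theorem IsSelfConformalSet.exists_ball_distortion [Nontrivial (E d)]
    (hF : S.IsSelfConformalSet F) {η : ℝ} (hη : 0 < η) :
    ∃ r > (0 : ℝ), ∀ y ∈ F, Metric.ball y r ⊆ S.Ω ∧ ∀ w : List (Fin N), ∀ x ∈ Metric.ball y r,
      ‖fderiv ℝ (S.wordMap w) x - fderiv ℝ (S.wordMap w) y‖ ≤
        η * ‖fderiv ℝ (S.wordMap w) y‖ := by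
  obtain ⟨a, ha, α, hα, h⟩ := hF.exists_distortion
  obtain ⟨r₀, hr₀, hball⟩ := hF.exists_ball_subset
  have hcont : Continuous fun t : ℝ => Real.exp (a * t ^ α) - 1 :=
    (Real.continuous_exp.comp (continuous_const.mul
      (Real.continuous_rpow_const hα.le))).sub continuous_const
  have hlt : ∀ᶠ t in nhds (0 : ℝ), Real.exp (a * t ^ α) - 1 < η :=
    hcont.continuousAt.eventually_lt continuousAt_const (by simp [Real.zero_rpow hα.ne', hη])
  obtain ⟨r₁, hr₁, h₁⟩ := Metric.eventually_nhds_iff.1 hlt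
  refine ⟨min r₀ r₁, lt_min hr₀ hr₁, fun y hy =>
    ⟨(Metric.ball_subset_ball (min_le_left _ _)).trans (hball y hy), fun w x hx => ?_⟩⟩
  refine (h w y hy x (hball y hy (Metric.ball_subset_ball (min_le_left _ _) hx))).trans ?_
  gcongr
  refine (h₁ ?_).le
  rw [Real.dist_eq, sub_zero, abs_of_nonneg (norm_nonneg _), ← dist_eq_norm]
  exact (Metric.mem_ball.1 hx).trans_le (min_le_right _ _)

/-- `φ_w` expands distances on the attractor at least by a fixed multiple of `‖φ_w'‖`. -/
theorem IsSelfConformalSet.exists_le_norm_wordMap_sub [Nontrivial (E d)]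
    (hF : S.IsSelfConformalSet F) :
    ∃ c > (0 : ℝ), ∀ w : List (Fin N), ∀ x ∈ F, ∀ y ∈ F,
      c * S.wordNorm w * ‖x - y‖ ≤ ‖S.wordMap w x - S.wordMap w y‖ := by
  obtain ⟨K, hK1, hK⟩ := hF.exists_wordNorm_le
  obtain ⟨r, hr, hball⟩ := hF.exists_ball_distortion (η := 1 / 2) (by norm_num)
  obtain ⟨D, hD⟩ := S.isBounded.exists_norm_le
  have hKpos : 0 < K := by linarith
  set R : ℝ := max 1 (D + D) with hR
  have hR1 : 1 ≤ R := le_max_left _ _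
  refine ⟨min (K⁻¹ / 2) (K⁻¹ / 2 * (r / 2) / R), by positivity, fun w x hx y hy => ?_⟩
  have hxΩ := hF.subset hx
  set L := fderiv ℝ (S.wordMap w) y with hL
  have hKL : K⁻¹ * S.wordNorm w ≤ ‖L‖ := by
    rw [inv_mul_le_iff₀ hKpos]; exact hK w y hy
  have hLpos : 0 < ‖L‖ := S.norm_fderiv_wordMap_pos w (hF.subset hy)
  have hW : 0 < S.wordNorm w := S.wordNorm_pos hF.nonempty_domain w
  obtain ⟨hsub, hdist⟩ := hball y hy
  have happrox : ∀ z ∈ Metric.ball y r, ∀ z' ∈ Metric.ball y r,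
      ‖S.wordMap w z - S.wordMap w z' - L (z - z')‖ ≤ 1 / 2 * ‖L‖ * ‖z - z'‖ :=
    fun z hz z' hz' => (convex_ball y r).norm_image_sub_le_of_norm_fderiv_le' (𝕜 := ℝ)
      (fun p hp => S.differentiableAt_wordMap w (hsub hp)) (fun p hp => hdist w p hp) hz' hz
  -- Near `y`, linearization loses at most half of `‖L‖`. Far from `y`, injectivity has to be used.
  by_cases hxr : x ∈ Metric.ball y r
  · have h1 := happrox x hxr y (Metric.mem_ball_self hr)
    have h2 := norm_le_norm_add_norm_sub' (L (x - y)) (S.wordMap w x - S.wordMap w y)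
    rw [norm_sub_rev (L (x - y)), hL, S.norm_fderiv_wordMap_apply w (hF.subset hy), ← hL] at h2
    calc min (K⁻¹ / 2) (K⁻¹ / 2 * (r / 2) / R) * S.wordNorm w * ‖x - y‖
        ≤ K⁻¹ / 2 * S.wordNorm w * ‖x - y‖ := by
          gcongr
          exact min_le_left _ _
      _ = (K⁻¹ * S.wordNorm w) * ‖x - y‖ / 2 := by ring
      _ ≤ ‖L‖ * ‖x - y‖ / 2 := by gcongr
      _ ≤ _ := by linarith
  · have hxy : ‖x - y‖ ≤ R :=
      ((norm_sub_le _ _).trans (add_le_add (hD x hxΩ) (hD y (hF.subset hy)))).trans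
        (le_max_right _ _)
    -- The inverse of the similarity `L` has norm `‖L‖⁻¹`, so the quantitative inverse function
    -- theorem shows that `φ_w` maps the ball of radius `r / 2` about `y` onto at least the ball of
    -- radius `‖L‖ / 2 * (r / 2)` about `φ_w(y)`. By injectivity on `Ω`, a point outside the larger
    -- ball cannot land there.
    have hfar : ‖L‖ / 2 * (r / 2) ≤ ‖S.wordMap w x - S.wordMap w y‖ := by
      by_contra! hlt
      have hker : L.ker = ⊥ := by
        rw [LinearMap.ker_eq_bot']
        intro v hv
        have h := S.norm_fderiv_wordMap_apply w (hF.subset hy) v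
        rw [← hL] at h
        have hv' : L v = 0 := hv
        rw [hv', norm_zero, eq_comm, mul_eq_zero] at h
        exact norm_eq_zero.1 (h.resolve_left hLpos.ne')
      have hsurj : Function.Surjective L :=
        LinearMap.surjective_of_injective (f := (L : E d →ₗ[ℝ] E d)) (LinearMap.ker_eq_bot.1 hker)
      choose inv hinv using hsurj
      let f'symm : L.NonlinearRightInverse :=
        { toFun := inv
          nnnorm := ‖L‖₊⁻¹
          bound' := fun v => by
            have h := S.norm_fderiv_wordMap_apply w (hF.subset hy) (inv v)
            rw [← hL, hinv] at h
            rw [NNReal.coe_inv, coe_nnnorm, h, inv_mul_cancel_left₀ hLpos.ne']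
          right_inv' := hinv }
      have hALO : ApproximatesLinearOn (S.wordMap w) L (Metric.closedBall y (r / 2))
          (‖L‖₊ / 2) := by
        intro z hz z' hz'
        have hcb := Metric.closedBall_subset_ball (x := y) (half_lt_self hr)
        refine (happrox z (hcb hz) z' (hcb hz')).trans_eq ?_
        push_cast
        ring
      have hs := hALO.surjOn_closedBall_of_nonlinearRightInverse f'symm
        (ε := r / 2) (by positivity) Subset.rfl
      have hmem : S.wordMap w x ∈ Metric.closedBall (S.wordMap w y)
          (((f'symm.nnnorm : ℝ)⁻¹ - (‖L‖₊ / 2 : NNReal)) * (r / 2)) := by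
        rw [Metric.mem_closedBall, dist_eq_norm]
        refine hlt.le.trans_eq ?_
        simp only [f'symm]
        push_cast
        rw [inv_inv]
        ring
      obtain ⟨z, hz, hzx⟩ := hs hmem
      have hz' := Metric.closedBall_subset_ball (x := y) (half_lt_self hr) hz
      exact hxr (S.injOn_wordMap w (hsub hz') hxΩ hzx ▸ hz')
    calc min (K⁻¹ / 2) (K⁻¹ / 2 * (r / 2) / R) * S.wordNorm w * ‖x - y‖
        ≤ K⁻¹ / 2 * (r / 2) / R * S.wordNorm w * R := by
          gcongr
          exact min_le_right _ _
      _ = (K⁻¹ * S.wordNorm w) / 2 * (r / 2) := by field_simp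
      _ ≤ ‖L‖ / 2 * (r / 2) := by gcongr
      _ ≤ _ := hfar

/-- The norms of words are multiplicative up to a constant. -/
theorem IsSelfConformalSet.exists_mul_wordNorm_le [Nontrivial (E d)]
    (hF : S.IsSelfConformalSet F) :
    ∃ K ≥ (1 : ℝ), ∀ u v : List (Fin N), S.wordNorm u * S.wordNorm v ≤ K * S.wordNorm (u ++ v) := by
  obtain ⟨K, hK1, hK⟩ := hF.exists_wordNorm_le
  obtain ⟨y, hy⟩ := hF.nonempty
  have hyΩ := hF.subset hy
  refine ⟨K * K, one_le_mul_of_one_le_of_one_le hK1 hK1, fun u v => ?_⟩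
  calc S.wordNorm u * S.wordNorm v
      ≤ (K * ‖fderiv ℝ (S.wordMap u) (S.wordMap v y)‖) * (K * ‖fderiv ℝ (S.wordMap v) y‖) :=
        mul_le_mul (hK u _ (hF.mapsTo v hy)) (hK v y hy)
          (S.wordNorm_pos hF.nonempty_domain v).le (by positivity)
    _ = K * K * ‖fderiv ℝ (S.wordMap (u ++ v)) y‖ := by
        rw [S.norm_fderiv_append u v hyΩ]; ring
    _ ≤ _ := by
        gcongr
        exact S.norm_fderiv_le_wordNorm _ hyΩ

/-- Norms of words decay geometrically with length; this supplies the length bound needed in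
`exists_last_word`. -/
theorem exists_wordNorm_lt [Nontrivial (E d)] (S : ConformalIFS d N) (hΩ : S.Ω.Nonempty)
    {t : ℝ} (ht : 0 < t) : ∃ n : ℕ, ∀ w : List (Fin N), t ≤ S.wordNorm w → w.length < n := by
  obtain ⟨l, hl0, hl1, hl⟩ := S.exists_contraction
  obtain ⟨n, hn⟩ := exists_pow_lt_of_lt_one ht hl1
  refine ⟨n, fun w hw => ?_⟩
  by_contra! hlen
  have h1 : S.wordNorm w ≤ l ^ w.length :=
    S.wordNorm_le hΩ w fun x hx => S.norm_fderiv_wordMap_le_pow hl0 hl w hx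
  have h2 := pow_le_pow_of_le_one hl0.le hl1.le hlen
  linarith

/-- Along some coding of a point of the attractor, a property of words of bounded length that
holds for the empty word holds for a last time. -/
theorem IsSelfConformalSet.exists_last_word (hF : S.IsSelfConformalSet F) {z : E d} (hz : z ∈ F)
    (P : List (Fin N) → Prop) (h0 : P []) (hb : ∃ n : ℕ, ∀ w, P w → w.length < n) :
    ∃ w i, z ∈ S.wordMap (w ++ [i]) '' F ∧ P w ∧ ¬ P (w ++ [i]) := by
  obtain ⟨n, hn⟩ := hb
  by_contra! hcon
  -- Without a last time, a coding of `z` could be prolonged forever inside `P`.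
  have : ∀ k : ℕ, ∃ w : List (Fin N), w.length = k ∧ z ∈ S.wordMap w '' F ∧ P w := by
    intro k
    induction k with
    | zero => exact ⟨[], rfl, ⟨z, hz, rfl⟩, h0⟩
    | succ k ih =>
      obtain ⟨w, hw, ⟨y, hy, rfl⟩, hP⟩ := ih
      rw [hF.invariant] at hy
      obtain ⟨i, y', hy', rfl⟩ := mem_iUnion.1 hy
      have hmem : S.wordMap w (S.φ i y') ∈ S.wordMap (w ++ [i]) '' F :=
        ⟨y', hy', S.wordMap_append_apply w [i] y'⟩
      exact ⟨w ++ [i], by simp [hw], hmem, hcon w i hmem hP⟩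
  obtain ⟨w, hw, -, hP⟩ := this n
  exact (hn w hP).ne hw

end Distortion
end ConformalIFS

/-! ### Uniform smallness implies a small Lipschitz constant -/

/-- A family of maps that is uniformly strictly differentiable along a compact set `F` with bounded
differentials: the members that are uniformly small on `F` have small Lipschitz constant on `F`. -/
theorem exists_lipschitz_of_small {ι V W : Type*} [NormedAddCommGroup V] [NormedSpace ℝ V]
    [FiniteDimensional ℝ V] [NormedAddCommGroup W] [NormedSpace ℝ W] [FiniteDimensional ℝ W]
    {F : Set V} (hF : IsCompact F) (h : ι → V → W) (L : ι → V → V →L[ℝ] W) {C : ℝ}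
    (hC : ∀ i, ∀ x ∈ F, ‖L i x‖ ≤ C)
    (hL : ∀ η > (0 : ℝ), ∃ r > (0 : ℝ), ∀ i, ∀ x ∈ F, ∀ y ∈ Metric.ball x r,
      ∀ y' ∈ Metric.ball x r, ‖h i y - h i y' - L i x (y - y')‖ ≤ η * ‖y - y'‖)
    {ε : ℝ} (hε : 0 < ε) :
    ∃ δ > (0 : ℝ), ∀ i, (∀ x ∈ F, ‖h i x‖ ≤ δ) →
      ∀ x ∈ F, ∀ y ∈ F, ‖h i x - h i y‖ ≤ ε * ‖x - y‖ := by
  -- Counterexamples with sup norms tending to zero are extracted so that their base points converge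
  -- to `p` and their linearizations at `p` converge to some `A`.
  by_contra! hcon
  choose i hsmall x hx y hy hxy using
    fun n : ℕ => hcon (1 / ((n : ℝ) + 1)) Nat.one_div_pos_of_nat
  obtain ⟨p, hp, f, hf, hfx⟩ := hF.tendsto_subseq hx
  obtain ⟨A, -, g, hg, hgA⟩ := (isCompact_closedBall (0 : V →L[ℝ] W) C).tendsto_subseq
    (x := fun n => L (i (f n)) p) fun n => by simpa using hC _ p hp
  set k : ℕ → ℕ := f ∘ g with hk
  have hkt : Filter.Tendsto k Filter.atTop Filter.atTop := hf.tendsto_atTop.comp hg.tendsto_atTop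
  have hkx : Filter.Tendsto (fun n => x (k n)) Filter.atTop (nhds p) := hfx.comp hg.tendsto_atTop
  have hzero : Filter.Tendsto (fun n => 1 / ((k n : ℝ) + 1)) Filter.atTop (nhds 0) :=
    tendsto_one_div_add_atTop_nhds_zero_nat.comp hkt
  -- The large difference quotient forces `‖x - y‖` to be at most `2 / ε` times the sup norm.
  have hky : Filter.Tendsto (fun n => y (k n)) Filter.atTop (nhds p) := by
    have hdiff : Filter.Tendsto (fun n => x (k n) - y (k n)) Filter.atTop (nhds 0) := by
      refine squeeze_zero_norm (a := fun n => 2 / ε * (1 / ((k n : ℝ) + 1))) (fun n => ?_) ?_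
      · have h1 := (hxy (k n)).le
        have h2 := (norm_sub_le (h (i (k n)) (x (k n))) (h (i (k n)) (y (k n)))).trans
          (add_le_add (hsmall (k n) _ (hx _)) (hsmall (k n) _ (hy _)))
        rw [div_mul_eq_mul_div, le_div_iff₀ hε]
        linarith
      · simpa using hzero.const_mul (2 / ε)
    simpa using hkx.sub hdiff
  obtain ⟨r, hr, hlin⟩ := hL (ε / 4) (by positivity)
  have hball : ∀ᶠ n in Filter.atTop,
      x (k n) ∈ Metric.ball p r ∧ y (k n) ∈ Metric.ball p r ∧ ‖L (i (k n)) p - A‖ < ε / 4 := by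
    have hb := Metric.ball_mem_nhds p hr
    refine (hkx.eventually_mem hb).and ((hky.eventually_mem hb).and ?_)
    have := Metric.tendsto_nhds.1 hgA (ε / 4) (by positivity)
    simpa [dist_eq_norm, hk] using this
  obtain ⟨n, hxn, hyn, hAn⟩ := hball.exists
  set e := x (k n) - y (k n) with he
  have hepos : 0 < ‖e‖ := by
    rw [norm_pos_iff]
    intro h0
    have h1 := hxy (k n)
    rw [sub_eq_zero.1 (show x (k n) - y (k n) = 0 from h0)] at h1
    simp at h1
  have hlow : ε / 2 * ‖e‖ < ‖A e‖ := by
    have h1 := hlin (i (k n)) p hp _ hxn _ hyn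
    have h2 := hxy (k n)
    have h3 : ‖(L (i (k n)) p - A) e‖ ≤ ε / 4 * ‖e‖ :=
      ((L (i (k n)) p - A).le_opNorm e).trans (by gcongr)
    have h4 := norm_le_norm_add_norm_sub' (h (i (k n)) (x (k n)) - h (i (k n)) (y (k n)))
      (L (i (k n)) p e)
    have h5 := norm_le_norm_add_norm_sub' (L (i (k n)) p e) (A e)
    rw [sub_apply] at h3
    linarith
  -- The pair of points defining `e` is now frozen while the index varies: the maps tend to zero at
  -- both points, so only the linearization error survives. This contradicts `hlow`.
  have hup : ‖A e‖ ≤ ε / 4 * ‖e‖ := by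
    have hlim1 : Filter.Tendsto (fun j => ‖L (i (k j)) p e‖) Filter.atTop (nhds ‖A e‖) :=
      (((ContinuousLinearMap.apply ℝ W e).continuous.tendsto A).comp hgA).norm
    have hlim2 : Filter.Tendsto (fun j => ε / 4 * ‖e‖ + 2 * (1 / ((k j : ℝ) + 1))) Filter.atTop
        (nhds (ε / 4 * ‖e‖)) := by simpa using (hzero.const_mul 2).const_add (ε / 4 * ‖e‖)
    refine le_of_tendsto_of_tendsto' hlim1 hlim2 fun j => ?_
    have h1 := hlin (i (k j)) p hp _ hxn _ hyn
    have h2 := (norm_sub_le (h (i (k j)) (x (k n))) (h (i (k j)) (y (k n)))).trans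
      (add_le_add (hsmall (k j) _ (hx _)) (hsmall (k j) _ (hy _)))
    have h3 := norm_le_norm_add_norm_sub (h (i (k j)) (x (k n)) - h (i (k j)) (y (k n)))
      (L (i (k j)) p e)
    linarith
  nlinarith

namespace ConformalIFS
variable {d N : ℕ}
-- Pairs of word maps that are close on the attractor
section Closeness
variable {S : ConformalIFS d N} {F : Set (E d)}

/-- The images of two fixed points of `F` are at a distance comparable to the norm of the word, and
replacing `u` by `v` changes this distance by at most twice the sup distance. -/
theorem IsSelfConformalSet.exists_wordNorm_le_of_close [Nontrivial (E d)]
    (hF : S.IsSelfConformalSet F) (hF2 : F.Nontrivial) :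
    ∃ C > (0 : ℝ), ∃ θ > (0 : ℝ), θ ≤ 1 ∧ ∀ u v : List (Fin N),
      ((∀ x ∈ F, ‖S.wordMap u x - S.wordMap v x‖ ≤ S.wordNorm u) →
        S.wordNorm v ≤ C * S.wordNorm u) ∧
      ((∀ x ∈ F, ‖S.wordMap u x - S.wordMap v x‖ ≤ θ * S.wordNorm u) →
        S.wordNorm u ≤ C * S.wordNorm v) := by
  obtain ⟨c, hc, hlow⟩ := hF.exists_le_norm_wordMap_sub
  obtain ⟨p, hp, q, hq, hpq⟩ := hF2
  have hpq0 : 0 < ‖p - q‖ := norm_pos_iff.2 (sub_ne_zero.2 hpq)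
  have tri : ∀ u v : List (Fin N), ∀ t : ℝ, (∀ x ∈ F, ‖S.wordMap u x - S.wordMap v x‖ ≤ t) →
      ‖S.wordMap v p - S.wordMap v q‖ ≤ ‖S.wordMap u p - S.wordMap u q‖ + 2 * t := by
    intro u v t ht
    have h1 := ht p hp
    have h2 := ht q hq
    have h3 : S.wordMap v p - S.wordMap v q = (S.wordMap u p - S.wordMap u q) -
      (S.wordMap u p - S.wordMap v p) + (S.wordMap u q - S.wordMap v q) := by abel
    rw [h3]
    linarith [norm_add_le (S.wordMap u p - S.wordMap u q - (S.wordMap u p - S.wordMap v p))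
      (S.wordMap u q - S.wordMap v q), norm_sub_le (S.wordMap u p - S.wordMap u q)
      (S.wordMap u p - S.wordMap v p)]
  -- With this `θ` the error `2θ‖φ_u'‖` is at most half of the lower bound `c‖φ_u'‖‖p - q‖`.
  refine ⟨max ((‖p - q‖ + 2) / (c * ‖p - q‖)) (2 / c), by positivity,
    min 1 (c * ‖p - q‖ / 4), by positivity, min_le_left _ _, fun u v => ⟨fun h => ?_, fun h => ?_⟩⟩
  · have hu := (S.wordNorm_pos hF.nonempty_domain u).le
    have h1 := tri u v _ h
    have h2 := hlow v p hp q hq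
    have h3 := S.norm_wordMap_sub_le u (hF.subset hp) (hF.subset hq)
    calc S.wordNorm v ≤ (‖p - q‖ + 2) / (c * ‖p - q‖) * S.wordNorm u := by
          rw [div_mul_eq_mul_div, le_div_iff₀ (by positivity)]
          linarith
      _ ≤ _ := by
          gcongr
          exact le_max_left _ _
  · have hu := (S.wordNorm_pos hF.nonempty_domain u).le
    have hv := (S.wordNorm_pos hF.nonempty_domain v).le
    have h1 := tri v u _ fun x hx => by rw [norm_sub_rev]; exact h x hx
    have h2 := hlow u p hp q hq
    have h3 := S.norm_wordMap_sub_le v (hF.subset hp) (hF.subset hq)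
    have h4 : min 1 (c * ‖p - q‖ / 4) * S.wordNorm u ≤ c * ‖p - q‖ / 4 * S.wordNorm u := by
      gcongr
      exact min_le_right _ _
    calc S.wordNorm u ≤ 2 / c * S.wordNorm v := by
          rw [div_mul_eq_mul_div, le_div_iff₀ hc]
          have : (S.wordNorm u * c) * ‖p - q‖ ≤ (2 * S.wordNorm v) * ‖p - q‖ := by linarith
          exact le_of_mul_le_mul_right this hpq0
      _ ≤ _ := by
          gcongr
          exact le_max_right _ _

/-- If `φ_u` and `φ_v` are uniformly close on the attractor, then their difference has a small
Lipschitz constant on the attractor. -/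
theorem IsSelfConformalSet.exists_lipschitz_of_close [Nontrivial (E d)]
    (hF : S.IsSelfConformalSet F) (hF2 : F.Nontrivial) {ε : ℝ} (hε : 0 < ε) :
    ∃ δ > (0 : ℝ), ∀ u v : List (Fin N),
      (∀ x ∈ F, ‖S.wordMap u x - S.wordMap v x‖ ≤ δ * S.wordNorm u) →
        ∀ x ∈ F, ∀ y ∈ F, ‖(S.wordMap u x - S.wordMap v x) - (S.wordMap u y - S.wordMap v y)‖ ≤
          ε * S.wordNorm u * ‖x - y‖ := by
  obtain ⟨C, hC, _, -, -, hcomp⟩ := hF.exists_wordNorm_le_of_close hF2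
  have hpos := S.wordNorm_pos hF.nonempty_domain
  -- Restricting to relative distance at most one makes `‖φ_v'‖` at most `C‖φ_u'‖`, so the
  -- normalized differences have bounded differentials.
  let ι := {p : List (Fin N) × List (Fin N) //
    ∀ x ∈ F, ‖S.wordMap p.1 x - S.wordMap p.2 x‖ ≤ S.wordNorm p.1}
  let h : ι → E d → E d := fun i x =>
    (S.wordNorm i.1.1)⁻¹ • (S.wordMap i.1.1 x - S.wordMap i.1.2 x)
  let L : ι → E d → E d →L[ℝ] E d := fun i x =>
    (S.wordNorm i.1.1)⁻¹ • (fderiv ℝ (S.wordMap i.1.1) x - fderiv ℝ (S.wordMap i.1.2) x)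
  have hsum : ∀ i : ι, ∀ x ∈ F, ‖fderiv ℝ (S.wordMap i.1.1) x‖ + ‖fderiv ℝ (S.wordMap i.1.2) x‖ ≤
      (1 + C) * S.wordNorm i.1.1 := fun i x hx => by
    linarith [S.norm_fderiv_le_wordNorm i.1.1 (hF.subset hx),
      S.norm_fderiv_le_wordNorm i.1.2 (hF.subset hx), (hcomp i.1.1 i.1.2).1 i.2]
  have hnorm : ∀ i : ι, ‖(S.wordNorm i.1.1)⁻¹‖ = (S.wordNorm i.1.1)⁻¹ := fun i =>
    Real.norm_of_nonneg (inv_nonneg.2 (hpos _).le)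
  obtain ⟨δ, hδ, hmain⟩ := exists_lipschitz_of_small hF.isCompact h L (C := 1 + C)
    (fun i x hx => by
      rw [norm_smul, hnorm, inv_mul_le_iff₀ (hpos _), mul_comm]
      exact (norm_sub_le _ _).trans (hsum i x hx))
    (fun η hη => by
      obtain ⟨r, hr, hball⟩ := hF.exists_ball_distortion (η := η / (1 + C)) (by positivity)
      refine ⟨r, hr, fun i x hx y hy y' hy' => ?_⟩
      obtain ⟨hsub, hdist⟩ := hball x hx
      have happrox : ∀ w : List (Fin N),
          ‖S.wordMap w y - S.wordMap w y' - fderiv ℝ (S.wordMap w) x (y - y')‖ ≤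
            η / (1 + C) * ‖fderiv ℝ (S.wordMap w) x‖ * ‖y - y'‖ := fun w =>
        (convex_ball x r).norm_image_sub_le_of_norm_fderiv_le' (𝕜 := ℝ)
          (fun p hp => S.differentiableAt_wordMap w (hsub hp)) (fun p hp => hdist w p hp) hy' hy
      have h1 := happrox i.1.1
      have h2 := happrox i.1.2
      have h3 := hsum i x hx
      have heq : h i y - h i y' - L i x (y - y') = (S.wordNorm i.1.1)⁻¹ •
          ((S.wordMap i.1.1 y - S.wordMap i.1.1 y' - fderiv ℝ (S.wordMap i.1.1) x (y - y')) -
          (S.wordMap i.1.2 y - S.wordMap i.1.2 y' - fderiv ℝ (S.wordMap i.1.2) x (y - y'))) := by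
        simp only [h, L, smul_apply, sub_apply, ← smul_sub]
        congr 1
        abel
      rw [heq, norm_smul, hnorm, inv_mul_le_iff₀ (hpos _)]
      refine (norm_sub_le _ _).trans ((add_le_add h1 h2).trans ?_)
      calc _ = η / (1 + C) * (‖fderiv ℝ (S.wordMap i.1.1) x‖ + ‖fderiv ℝ (S.wordMap i.1.2) x‖) *
            ‖y - y'‖ := by ring
        _ ≤ η / (1 + C) * ((1 + C) * S.wordNorm i.1.1) * ‖y - y'‖ := by gcongr
        _ = _ := by field_simp) hε
  refine ⟨min δ 1, by positivity, fun u v huv x hx y hy => ?_⟩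
  have hu := hpos u
  have huv1 : ∀ x ∈ F, ‖S.wordMap u x - S.wordMap v x‖ ≤ S.wordNorm u := fun x hx =>
    (huv x hx).trans (mul_le_of_le_one_left hu.le (min_le_right _ _))
  have := hmain ⟨(u, v), huv1⟩ (fun x hx => by
    simp only [h]
    rw [norm_smul, norm_inv, Real.norm_of_nonneg hu.le, inv_mul_le_iff₀ hu, mul_comm]
    exact (huv x hx).trans (by gcongr; exact min_le_left _ _)) x hx y hy
  simp only [h] at this
  rw [← smul_sub, norm_smul, norm_inv, Real.norm_of_nonneg hu.le, inv_mul_le_iff₀ hu] at this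
  linarith

end Closeness
-- Diameters of cylinders
section WeakSeparation
variable {S : ConformalIFS d N} {F : Set (E d)}

theorem IsSelfConformalSet.continuousOn_wordMap (hF : S.IsSelfConformalSet F)
    (w : List (Fin N)) : ContinuousOn (S.wordMap w) F :=
  (S.continuousOn_wordMap w).mono hF.subset

theorem IsSelfConformalSet.isBounded_image (hF : S.IsSelfConformalSet F) (w : List (Fin N)) :
    Bornology.IsBounded (S.wordMap w '' F) :=
  (hF.isCompact.image_of_continuousOn (hF.continuousOn_wordMap w)).isBounded

theorem IsSelfConformalSet.bddAbove_norm_sub (hF : S.IsSelfConformalSet F)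
    (u v : List (Fin N)) :
    BddAbove (range fun x : F => ‖S.wordMap u x - S.wordMap v x‖) := by
  have h := (hF.isCompact.image_of_continuousOn
    ((hF.continuousOn_wordMap u).sub (hF.continuousOn_wordMap v)).norm).bddAbove
  rwa [image_eq_range] at h

theorem IsSelfConformalSet.exists_norm_sub_le (hF : S.IsSelfConformalSet F) :
    ∃ D > (0 : ℝ), ∀ x ∈ F, ∀ y ∈ F, ‖x - y‖ ≤ D := by
  obtain ⟨D, hD⟩ := hF.isCompact.isBounded.exists_norm_le
  refine ⟨max 1 (D + D), by positivity, fun x hx y hy => ?_⟩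
  exact ((norm_sub_le _ _).trans (add_le_add (hD x hx) (hD y hy))).trans (le_max_right _ _)

theorem IsSelfConformalSet.diam_image_le [Nontrivial (E d)] (hF : S.IsSelfConformalSet F) {D : ℝ}
    (hD0 : 0 ≤ D) (hD : ∀ x ∈ F, ∀ y ∈ F, ‖x - y‖ ≤ D) (w : List (Fin N)) :
    Metric.diam (S.wordMap w '' F) ≤ S.wordNorm w * D := by
  have hw := (S.wordNorm_pos hF.nonempty_domain w).le
  refine Metric.diam_le_of_forall_dist_le (by positivity) ?_
  rintro _ ⟨x, hx, rfl⟩ _ ⟨y, hy, rfl⟩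
  rw [dist_eq_norm]
  exact (S.norm_wordMap_sub_le w (hF.subset hx) (hF.subset hy)).trans
    (by gcongr; exact hD x hx y hy)

/-- The diameter of a cylinder set is at least a fixed multiple of the norm of the word. -/
theorem IsSelfConformalSet.exists_le_diam_image [Nontrivial (E d)] (hF : S.IsSelfConformalSet F)
    (hF2 : F.Nontrivial) :
    ∃ b > (0 : ℝ), ∀ w : List (Fin N), b * S.wordNorm w ≤ Metric.diam (S.wordMap w '' F) := by
  obtain ⟨c, hc, hlow⟩ := hF.exists_le_norm_wordMap_sub
  obtain ⟨p, hp, q, hq, hpq⟩ := hF2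
  have hpq0 : 0 < ‖p - q‖ := norm_pos_iff.2 (sub_ne_zero.2 hpq)
  refine ⟨c * ‖p - q‖, by positivity, fun w => ?_⟩
  have h1 := Metric.dist_le_diam_of_mem (hF.isBounded_image w) (mem_image_of_mem _ hp)
    (mem_image_of_mem _ hq)
  rw [dist_eq_norm] at h1
  linarith [hlow w p hp q hq]

/-- Appending a letter decreases the norm of a word at most by a fixed factor. -/
theorem IsSelfConformalSet.exists_wordNorm_le_append_singleton [Nontrivial (E d)]
    (hF : S.IsSelfConformalSet F) :
    ∃ C > (0 : ℝ), ∀ (w : List (Fin N)) (i : Fin N),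
      S.wordNorm w ≤ C * S.wordNorm (w ++ [i]) := by
  obtain ⟨K, hK1, hK⟩ := hF.exists_mul_wordNorm_le
  obtain ⟨m, hm0, hm⟩ := hF.exists_norm_fderiv_ge
  obtain ⟨y, hy⟩ := hF.nonempty
  refine ⟨K / m, by positivity, fun w i => ?_⟩
  have h1 : m ≤ S.wordNorm [i] := (hm i y hy).trans (S.norm_fderiv_le_wordNorm [i] (hF.subset hy))
  have hw := (S.wordNorm_pos hF.nonempty_domain w).le
  rw [div_mul_eq_mul_div, le_div_iff₀ hm0]
  exact (mul_le_mul_of_nonneg_left h1 hw).trans (hK w [i])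

theorem wordNorm_le_one [Nontrivial (E d)] (S : ConformalIFS d N) (hΩ : S.Ω.Nonempty)
    (w : List (Fin N)) : S.wordNorm w ≤ 1 := by
  obtain ⟨l, hl0, hl1, hl⟩ := S.exists_contraction
  exact S.wordNorm_le hΩ w fun x hx =>
    (S.norm_fderiv_wordMap_le_pow hl0 hl w hx).trans (pow_le_one₀ hl0.le hl1.le)

/-! ### Clusters of words when the criterion fails -/

/-- The word `g` arises from `g₀` by replacing a subword `u` by `v`, where `φ_u` and `φ_v` are
close on `F` relative to the size of the cylinder of `g₀`. -/
def CloseWords (S : ConformalIFS d N) (F : Set (E d)) (θ : ℝ) (g₀ g : List (Fin N)) : Prop :=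
  ∃ q u v s : List (Fin N), g₀ = q ++ (u ++ s) ∧ g = q ++ (v ++ s) ∧
    ∀ x ∈ F, ‖S.wordMap u x - S.wordMap v x‖ ≤ θ * (S.wordNorm u * S.wordNorm s)

theorem CloseWords.refl [Nontrivial (E d)] (hF : S.IsSelfConformalSet F) {θ : ℝ} (hθ : 0 ≤ θ)
    (g : List (Fin N)) : S.CloseWords F θ g g :=
  ⟨[], [], [], g, by simp, by simp, fun x _ => by
    have := (S.wordNorm_pos hF.nonempty_domain g).le
    have := (S.wordNorm_pos hF.nonempty_domain []).le
    simp only [sub_self, norm_zero]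
    positivity⟩

/-- The closeness bound does not involve the common prefix, so `θ` does not deteriorate. -/
theorem CloseWords.append_left {θ : ℝ} {g₀ g : List (Fin N)} (h : S.CloseWords F θ g₀ g)
    (q : List (Fin N)) : S.CloseWords F θ (q ++ g₀) (q ++ g) := by
  obtain ⟨q', u, v, s, rfl, rfl, h⟩ := h
  exact ⟨q ++ q', u, v, s, by simp, by simp, h⟩

/-- If the identity limit criterion fails, there are pairs of words with arbitrarily small positive
relative distance; the distance is witnessed at a point where it is maximal. -/
theorem IsSelfConformalSet.exists_pair_of_not_criterion [Nontrivial (E d)]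
    (hF : S.IsSelfConformalSet F) (hI : ¬ S.IdentityLimitCriterion F) {c : ℝ} (hc : 0 < c) :
    ∃ u v : List (Fin N), ∃ δ : ℝ, 0 < δ ∧ δ < c ∧
      (∀ x ∈ F, ‖S.wordMap u x - S.wordMap v x‖ ≤ δ * S.wordNorm u) ∧
      ∃ z ∈ F, ‖S.wordMap u z - S.wordMap v z‖ = δ * S.wordNorm u := by
  simp only [IdentityLimitCriterion] at hI
  push Not at hI
  obtain ⟨u, v, hne, hlt⟩ := hI c hc
  have hu := S.wordNorm_pos hF.nonempty_domain u
  obtain ⟨z, hz, hmax⟩ := hF.isCompact.exists_isMaxOn hF.nonempty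
    ((hF.continuousOn_wordMap u).sub (hF.continuousOn_wordMap v)).norm
  have heq : ‖S.wordMap u z - S.wordMap v z‖ =
      ((S.wordNorm u)⁻¹ * ‖S.wordMap u z - S.wordMap v z‖) * S.wordNorm u := by
    field_simp
  refine ⟨u, v, (S.wordNorm u)⁻¹ * ‖S.wordMap u z - S.wordMap v z‖, ?_, ?_, ?_, z, hz, heq⟩
  · refine mul_pos (inv_pos.2 hu) (lt_of_not_ge fun h0 => hne ?_)
    funext x
    have h1 : ‖S.wordMap u x - S.wordMap v x‖ ≤ 0 := (hmax x.2).trans h0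
    exact sub_eq_zero.1 (norm_le_zero_iff.1 h1)
  · refine lt_of_le_of_lt ?_ hlt
    refine mul_le_mul_of_nonneg_left ?_ (inv_nonneg.2 hu.le)
    exact le_ciSup (hF.bddAbove_norm_sub u v) ⟨z, hz⟩
  · intro x hx
    rw [← heq]
    exact hmax hx

theorem IsSelfConformalSet.exists_pos_le_norm_sub (hF : S.IsSelfConformalSet F)
    {g g' : List (Fin N)} (h : ∀ x ∈ F, S.wordMap g x ≠ S.wordMap g' x) :
    ∃ γ > (0 : ℝ), ∀ x ∈ F, γ ≤ ‖S.wordMap g x - S.wordMap g' x‖ := by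
  obtain ⟨z, hz, hmin⟩ := hF.isCompact.exists_isMinOn hF.nonempty
    ((hF.continuousOn_wordMap g).sub (hF.continuousOn_wordMap g')).norm
  exact ⟨_, norm_pos_iff.2 (sub_ne_zero.2 (h z hz)), fun x hx => hmin hx⟩

/-- Given a word `g₀` and constants, a failure of the identity limit criterion gives a pair `u`, `v`
and a word `w` such that `φ_u` and `φ_v` differ everywhere on `φ_w(F)`, while the cylinder of `w` is
large compared with the relative distance of `φ_u` and `φ_v`. -/
theorem IsSelfConformalSet.exists_separating_words [Nontrivial (E d)]
    (hF : S.IsSelfConformalSet F) (hF2 : F.Nontrivial) (hI : ¬ S.IdentityLimitCriterion F)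
    {B : ℝ} (hB : 0 < B) :
    ∃ u v w : List (Fin N), ∃ δ : ℝ, 0 < δ ∧ B * δ ≤ S.wordNorm w ∧
      (∀ x ∈ F, ‖S.wordMap u x - S.wordMap v x‖ ≤ δ * S.wordNorm u) ∧
      ∀ x ∈ F, S.wordMap u (S.wordMap w x) ≠ S.wordMap v (S.wordMap w x) := by
  obtain ⟨C, hC, hCw⟩ := hF.exists_wordNorm_le_append_singleton
  obtain ⟨D, hD0, hD⟩ := hF.exists_norm_sub_le
  -- Points of `φ_w(F)` will be within `C * (B * δ) * D` of `z`; with this `ε` the difference of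
  -- `φ_u` and `φ_v` varies over that distance by at most half its value at `z`.
  obtain ⟨δ₀, hδ₀, hlip⟩ := hF.exists_lipschitz_of_close hF2 (ε := 1 / (2 * (C * B * D)))
    (by positivity)
  obtain ⟨u, v, δ, hδ, hδc, hle, z, hz, hzeq⟩ :=
    hF.exists_pair_of_not_criterion hI (c := min δ₀ B⁻¹) (by positivity)
  have hu := S.wordNorm_pos hF.nonempty_domain u
  -- Stopping at the last word with norm at least `B * δ` also bounds its norm by `C * (B * δ)`. The
  -- bound `δ < B⁻¹` lets the empty word qualify.
  obtain ⟨w, i, ⟨y, hy, hyz⟩, hw, hwi⟩ := hF.exists_last_word hz (fun w => B * δ ≤ S.wordNorm w)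
    (by
      rw [S.wordNorm_nil hF.nonempty_domain]
      have := mul_le_mul_of_nonneg_left (hδc.le.trans (min_le_right _ _)) hB.le
      rwa [mul_inv_cancel₀ hB.ne'] at this)
    (S.exists_wordNorm_lt hF.nonempty_domain (mul_pos hB hδ))
  refine ⟨u, v, w, δ, hδ, hw, hle, fun x hx heq => ?_⟩
  have hy' : S.wordMap [i] y ∈ F := hF.mapsTo [i] hy
  rw [S.wordMap_append_apply] at hyz
  have hwx := hF.mapsTo w hx
  have h1 := hlip u v (fun x hx => (hle x hx).trans
    (by gcongr; exact hδc.le.trans (min_le_left _ _))) z hz _ hwx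
  rw [heq, sub_self, sub_zero, hzeq] at h1
  have h2 : ‖z - S.wordMap w x‖ ≤ C * (B * δ) * D := by
    rw [← hyz]
    refine (S.norm_wordMap_sub_le w (hF.subset hy') (hF.subset hx)).trans ?_
    have h3 : S.wordNorm w ≤ C * (B * δ) := (hCw w i).trans (by
      have := (not_le.1 hwi).le
      gcongr)
    gcongr
    exact hD _ hy' _ hx
  have h4 : δ * S.wordNorm u ≤ δ * S.wordNorm u / 2 := by
    refine h1.trans ?_
    calc _ ≤ 1 / (2 * (C * B * D)) * S.wordNorm u * (C * (B * δ) * D) := by gcongr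
      _ = _ := by field_simp
  have : 0 < δ * S.wordNorm u := by positivity
  linarith

/-- If the identity limit criterion fails, there are arbitrarily large clusters of words whose maps
differ pairwise at every point of the attractor. -/
theorem IsSelfConformalSet.exists_cluster [Nontrivial (E d)]
    (hF : S.IsSelfConformalSet F) (hF2 : F.Nontrivial) (hI : ¬ S.IdentityLimitCriterion F)
    {θ : ℝ} (hθ : 0 < θ) (n : ℕ) :
    ∃ g₀ : List (Fin N), ∃ T : Finset (List (Fin N)), T.card = n + 1 ∧ g₀ ∈ T ∧
      (∀ g ∈ T, S.CloseWords F θ g₀ g) ∧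
      ∀ g ∈ T, ∀ g' ∈ T, g ≠ g' → ∀ x ∈ F, S.wordMap g x ≠ S.wordMap g' x := by
  have hpos := S.wordNorm_pos hF.nonempty_domain
  induction n with
  | zero =>
    refine ⟨[], {[]}, by simp, by simp, fun g hg => ?_, fun g hg g' hg' hne => ?_⟩
    · rw [Finset.mem_singleton.1 hg]
      exact CloseWords.refl hF hθ.le _
    · exact absurd ((Finset.mem_singleton.1 hg).trans (Finset.mem_singleton.1 hg').symm) hne
  | succ n ih =>
    obtain ⟨g₀, T, hcard, hg₀, hclose, hsep⟩ := ih
    obtain ⟨K, hK1, hK⟩ := hF.exists_mul_wordNorm_le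
    obtain ⟨c, hc, hlow⟩ := hF.exists_le_norm_wordMap_sub
    have hKpos : 0 < K := by linarith
    obtain ⟨γ, hγ, hγle⟩ : ∃ γ > (0 : ℝ), ∀ g ∈ T, g ≠ g₀ → ∀ x ∈ F,
        γ ≤ ‖S.wordMap g x - S.wordMap g₀ x‖ := by
      have : ∀ g : List (Fin N), ∃ γ > (0 : ℝ), g ∈ T → g ≠ g₀ → ∀ x ∈ F,
          γ ≤ ‖S.wordMap g x - S.wordMap g₀ x‖ := fun g => by
        by_cases h : g ∈ T ∧ g ≠ g₀
        · obtain ⟨γ, hγ, h'⟩ := hF.exists_pos_le_norm_sub (hsep g h.1 g₀ hg₀ h.2)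
          exact ⟨γ, hγ, fun _ _ => h'⟩
        · exact ⟨1, one_pos, fun h1 h2 => absurd ⟨h1, h2⟩ h⟩
      choose γ hγ h' using this
      obtain ⟨g₁, -, hg₁⟩ := T.exists_min_image γ ⟨g₀, hg₀⟩
      exact ⟨γ g₁, hγ g₁, fun g hg hne x hx => (hg₁ g hg).trans (h' g hg hne x hx)⟩
    have hg₀pos := hpos g₀
    -- The first summand of `B` separates the new word from the old ones, the second makes it close
    -- to the new base word.
    obtain ⟨u, v, w, δ, hδ, hw, hle, hne⟩ := hF.exists_separating_words hF2 hI
      (B := 2 * K / (c * γ) + K / (θ * S.wordNorm g₀)) (by positivity)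
    have hupos := hpos u
    -- For `g = g₀` this is the choice of `w`. Otherwise `uwg` and `uwg₀` are at least `c‖φ_uw'‖γ`
    -- apart, which exceeds the distance `δ‖φ_u'‖` allowed between `vwg₀` and `uwg₀`.
    have hnew : ∀ g ∈ T, ∀ x ∈ F, S.wordMap (v ++ (w ++ g₀)) x ≠ S.wordMap (u ++ w ++ g) x := by
      intro g hg x hx heq
      have hx₀ := hF.mapsTo g₀ hx
      simp only [S.wordMap_append_apply] at heq
      by_cases hgg : g = g₀
      · subst hgg
        exact hne _ hx₀ heq.symm
      · have h1 := hlow (u ++ w) _ (hF.mapsTo g hx) _ hx₀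
        rw [S.wordMap_append_apply, S.wordMap_append_apply, ← heq,
          norm_sub_rev (S.wordMap v _)] at h1
        have h2 := hle _ (hF.mapsTo w hx₀)
        have h3 := hγle g hg hgg x hx
        have h4 : 2 * K / (c * γ) * δ ≤ S.wordNorm w := by
          refine le_trans ?_ hw
          have : 0 < K / (θ * S.wordNorm g₀) := by positivity
          gcongr
          linarith
        have h5 : c * S.wordNorm (u ++ w) * γ ≤ δ * S.wordNorm u :=
          le_trans (by have := hpos (u ++ w); gcongr) (h1.trans h2)
        have h6 : 2 * (K * (δ * S.wordNorm u)) ≤ K * (δ * S.wordNorm u) := by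
          calc 2 * (K * (δ * S.wordNorm u))
              = c * γ * (S.wordNorm u * (2 * K / (c * γ) * δ)) := by field_simp
            _ ≤ c * γ * (S.wordNorm u * S.wordNorm w) := by gcongr
            _ ≤ c * γ * (K * S.wordNorm (u ++ w)) :=
                mul_le_mul_of_nonneg_left (hK u w) (by positivity)
            _ = K * (c * S.wordNorm (u ++ w) * γ) := by ring
            _ ≤ _ := by gcongr
        have : 0 < K * (δ * S.wordNorm u) := by positivity
        linarith
    obtain ⟨x₀, hx₀⟩ := hF.nonempty
    have hnotMem : v ++ (w ++ g₀) ∉ T.image (u ++ w ++ ·) := by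
      intro hmem
      obtain ⟨g, hg, heq⟩ := Finset.mem_image.1 hmem
      exact hnew g hg x₀ hx₀ (by rw [← heq])
    refine ⟨u ++ w ++ g₀, insert (v ++ (w ++ g₀)) (T.image (u ++ w ++ ·)), ?_, ?_, ?_, ?_⟩
    · rw [Finset.card_insert_of_notMem hnotMem,
        Finset.card_image_of_injective _ (List.append_right_injective _), hcard]
    · exact Finset.mem_insert_of_mem (Finset.mem_image_of_mem _ hg₀)
    · intro g hg
      rcases Finset.mem_insert.1 hg with rfl | hg
      · refine ⟨[], u, v, w ++ g₀, by simp, by simp, fun x hx => (hle x hx).trans ?_⟩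
        have h4 : K / (θ * S.wordNorm g₀) * δ ≤ S.wordNorm w := by
          refine le_trans ?_ hw
          have : 0 < 2 * K / (c * γ) := by positivity
          gcongr
          linarith
        have h5 : K * δ ≤ K * (θ * S.wordNorm (w ++ g₀)) := by
          calc K * δ = θ * (K / (θ * S.wordNorm g₀) * δ * S.wordNorm g₀) := by field_simp
            _ ≤ θ * (S.wordNorm w * S.wordNorm g₀) := by gcongr
            _ ≤ θ * (K * S.wordNorm (w ++ g₀)) := mul_le_mul_of_nonneg_left (hK w g₀) hθ.le
            _ = _ := by ring
        have h6 : δ ≤ θ * S.wordNorm (w ++ g₀) := le_of_mul_le_mul_left h5 hKpos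
        calc δ * S.wordNorm u ≤ θ * S.wordNorm (w ++ g₀) * S.wordNorm u := by gcongr
          _ = _ := by ring
      · obtain ⟨g, hgT, rfl⟩ := Finset.mem_image.1 hg
        exact (hclose g hgT).append_left _
    · intro g hg g' hg' hgg x hx
      rcases Finset.mem_insert.1 hg with rfl | hg <;> rcases Finset.mem_insert.1 hg' with rfl | hg'
      · exact absurd rfl hgg
      · obtain ⟨g', hgT', rfl⟩ := Finset.mem_image.1 hg'
        exact hnew g' hgT' x hx
      · obtain ⟨g, hgT, rfl⟩ := Finset.mem_image.1 hg
        exact (hnew g hgT x hx).symm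
      · obtain ⟨g, hgT, rfl⟩ := Finset.mem_image.1 hg
        obtain ⟨g', hgT', rfl⟩ := Finset.mem_image.1 hg'
        rw [S.wordMap_append_apply (u ++ w), S.wordMap_append_apply (u ++ w)]
        exact fun heq => hsep g hgT g' hgT' (fun h => hgg (by rw [h])) x hx
          (S.injOn_wordMap _ (hF.subset (hF.mapsTo g hx)) (hF.subset (hF.mapsTo g' hx)) heq)

/-- Close words have comparable norms and nearby maps. -/
theorem IsSelfConformalSet.exists_closeWords_bounds [Nontrivial (E d)]
    (hF : S.IsSelfConformalSet F) (hF2 : F.Nontrivial) :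
    ∃ A > (0 : ℝ), ∃ θ₀ > (0 : ℝ), ∀ θ > 0, θ ≤ θ₀ → ∀ g₀ g : List (Fin N),
      S.CloseWords F θ g₀ g → S.wordNorm g₀ ≤ A * S.wordNorm g ∧
        S.wordNorm g ≤ A * S.wordNorm g₀ ∧
        ∀ x ∈ F, ‖S.wordMap g x - S.wordMap g₀ x‖ ≤ A * θ * S.wordNorm g₀ := by
  obtain ⟨C, hC, θ₀, hθ₀, hθ1, hcomp⟩ := hF.exists_wordNorm_le_of_close hF2
  obtain ⟨K, hK1, hK⟩ := hF.exists_mul_wordNorm_le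
  have hpos := S.wordNorm_pos hF.nonempty_domain
  have hKpos : 0 < K := by linarith
  -- `K * K` pays for splitting into three factors, and `C + 1` for exchanging `u` and `v`; being at
  -- least one, it also fits the distance bound.
  refine ⟨(C + 1) * (K * K), by positivity, θ₀, hθ₀, ?_⟩
  rintro θ hθ hθle _ _ ⟨q, u, v, s, rfl, rfl, h⟩
  have hq := hpos q
  have hu := hpos u
  have hv := hpos v
  have hs := hpos s
  have hlower : ∀ a : List (Fin N), S.wordNorm q * (S.wordNorm a * S.wordNorm s) ≤
      K * K * S.wordNorm (q ++ (a ++ s)) := fun a => by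
    calc _ ≤ S.wordNorm q * (K * S.wordNorm (a ++ s)) :=
          mul_le_mul_of_nonneg_left (hK a s) hq.le
      _ = K * (S.wordNorm q * S.wordNorm (a ++ s)) := by ring
      _ ≤ K * (K * S.wordNorm (q ++ (a ++ s))) :=
          mul_le_mul_of_nonneg_left (hK _ _) hKpos.le
      _ = _ := by ring
  have hupper : ∀ a : List (Fin N), S.wordNorm (q ++ (a ++ s)) ≤
      S.wordNorm q * (S.wordNorm a * S.wordNorm s) := fun a =>
    (S.wordNorm_append_le hF.nonempty_domain _ _).trans
      (mul_le_mul_of_nonneg_left (S.wordNorm_append_le hF.nonempty_domain _ _) hq.le)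
  have h' : ∀ x ∈ F, ‖S.wordMap u x - S.wordMap v x‖ ≤ θ₀ * S.wordNorm u := fun x hx => by
    refine (h x hx).trans ?_
    have := S.wordNorm_le_one hF.nonempty_domain s
    have : S.wordNorm u * S.wordNorm s ≤ S.wordNorm u := mul_le_of_le_one_right hu.le this
    gcongr
  have hvu : S.wordNorm v ≤ (C + 1) * S.wordNorm u := by
    have := (hcomp u v).1 fun x hx => (h' x hx).trans (mul_le_of_le_one_left hu.le hθ1)
    linarith
  have huv : S.wordNorm u ≤ (C + 1) * S.wordNorm v := by
    have := (hcomp u v).2 h'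
    linarith
  refine ⟨?_, ?_, fun x hx => ?_⟩
  · calc _ ≤ S.wordNorm q * (S.wordNorm u * S.wordNorm s) := hupper u
      _ ≤ S.wordNorm q * (((C + 1) * S.wordNorm v) * S.wordNorm s) := by gcongr
      _ = (C + 1) * (S.wordNorm q * (S.wordNorm v * S.wordNorm s)) := by ring
      _ ≤ (C + 1) * (K * K * S.wordNorm (q ++ (v ++ s))) :=
          mul_le_mul_of_nonneg_left (hlower v) (by positivity)
      _ = _ := by ring
  · calc _ ≤ S.wordNorm q * (S.wordNorm v * S.wordNorm s) := hupper v
      _ ≤ S.wordNorm q * (((C + 1) * S.wordNorm u) * S.wordNorm s) := by gcongr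
      _ = (C + 1) * (S.wordNorm q * (S.wordNorm u * S.wordNorm s)) := by ring
      _ ≤ (C + 1) * (K * K * S.wordNorm (q ++ (u ++ s))) :=
          mul_le_mul_of_nonneg_left (hlower u) (by positivity)
      _ = _ := by ring
  · have hsx := hF.mapsTo s hx
    simp only [S.wordMap_append_apply]
    calc _ ≤ S.wordNorm q * ‖S.wordMap v (S.wordMap s x) - S.wordMap u (S.wordMap s x)‖ :=
          S.norm_wordMap_sub_le q (hF.subset (hF.mapsTo v hsx)) (hF.subset (hF.mapsTo u hsx))
      _ ≤ S.wordNorm q * (θ * (S.wordNorm u * S.wordNorm s)) := by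
          rw [norm_sub_rev]
          gcongr
          exact h _ hsx
      _ = θ * (S.wordNorm q * (S.wordNorm u * S.wordNorm s)) := by ring
      _ ≤ θ * (K * K * S.wordNorm (q ++ (u ++ s))) :=
          mul_le_mul_of_nonneg_left (hlower u) hθ.le
      _ ≤ (C + 1) * (θ * (K * K * S.wordNorm (q ++ (u ++ s)))) := by
          have := hpos (q ++ (u ++ s))
          refine le_mul_of_one_le_left (by positivity) (by linarith)
      _ = _ := by ring

/-- A sufficiently large cluster is extended to cylinders of one common size `r` near one point. The
extensions have length at most `m`, independent of the cluster, so the cluster size is at most `M`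
times the number of such suffixes. -/
theorem IsSelfConformalSet.identityLimitCriterion_of_weakSeparation [Nontrivial (E d)]
    (hF : S.IsSelfConformalSet F) (hF2 : F.Nontrivial) (hW : S.WeakSeparation F) :
    S.IdentityLimitCriterion F := by
  by_contra hI
  have hpos := S.wordNorm_pos hF.nonempty_domain
  obtain ⟨M, hM⟩ := hW
  obtain ⟨A, hA, θ₀, hθ₀, hbounds⟩ := hF.exists_closeWords_bounds hF2
  obtain ⟨b, hb, hdiam⟩ := hF.exists_le_diam_image hF2
  obtain ⟨D, hD0, hD⟩ := hF.exists_norm_sub_le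
  -- Then `r = ρ‖φ_g₀'‖` is less than the diameter of `φ_g(F)` for every `g` in the cluster, so
  -- stopping at size `r` begins from the empty suffix.
  set ρ : ℝ := b / (2 * A) with hρ
  have hρ0 : 0 < ρ := by positivity
  obtain ⟨m, hm⟩ := S.exists_wordNorm_lt hF.nonempty_domain (t := ρ / (A * D)) (by positivity)
  have hfin : {l : List (Fin N) | l.length ≤ m}.Finite := List.finite_length_le _ _
  obtain ⟨g₀, T, hcard, hg₀, hclose, hsep⟩ := hF.exists_cluster hF2 hI (θ := min θ₀ (ρ / A))
    (by positivity) (M * hfin.toFinset.card)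
  have hg₀pos := hpos g₀
  have hbd : ∀ g ∈ T, S.wordNorm g₀ ≤ A * S.wordNorm g ∧ S.wordNorm g ≤ A * S.wordNorm g₀ ∧
      ∀ x ∈ F, ‖S.wordMap g x - S.wordMap g₀ x‖ ≤ ρ * S.wordNorm g₀ := by
    intro g hg
    obtain ⟨h1, h2, h3⟩ := hbounds _ (by positivity) (min_le_left _ _) g₀ g (hclose g hg)
    refine ⟨h1, h2, fun x hx => (h3 x hx).trans ?_⟩
    calc A * min θ₀ (ρ / A) * S.wordNorm g₀ ≤ A * (ρ / A) * S.wordNorm g₀ := by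
          gcongr
          exact min_le_right _ _
      _ = _ := by field_simp
  obtain ⟨x₁, hx₁⟩ := hF.nonempty
  set r := ρ * S.wordNorm g₀ with hr
  have hr0 : 0 < r := by positivity
  -- The suffix follows a coding of the fixed point `x₁`, so the extended cylinder contains
  -- `φ_g(x₁)`, which is within `r` of `φ_g₀(x₁)`.
  have hext : ∀ g ∈ T, ∃ l : List (Fin N), l.length ≤ m ∧ x₁ ∈ S.wordMap l '' F ∧
      F.domRestrict (S.wordMap (g ++ l)) ∈ S.Phi F (S.wordMap g₀ x₁) r := by
    intro g hg
    obtain ⟨h1, h2, h3⟩ := hbd g hg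
    have hgpos := hpos g
    have hlen : ∀ l, r < Metric.diam (S.wordMap (g ++ l) '' F) → l.length < m := by
      intro l hl
      have h4 := hl.le.trans (hF.diam_image_le hD0.le hD (g ++ l))
      have h5 := S.wordNorm_append_le hF.nonempty_domain g l
      have hlpos := hpos l
      refine hm l ?_
      rw [div_le_iff₀ (by positivity)]
      refine le_of_mul_le_mul_right ?_ hg₀pos
      calc ρ * S.wordNorm g₀ ≤ S.wordNorm (g ++ l) * D := h4
        _ ≤ (S.wordNorm g * S.wordNorm l) * D := by gcongr
        _ ≤ ((A * S.wordNorm g₀) * S.wordNorm l) * D := by gcongr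
        _ = _ := by ring
    obtain ⟨w, i, hx, hP, hP'⟩ := hF.exists_last_word hx₁
      (fun l => r < Metric.diam (S.wordMap (g ++ l) '' F))
      (by
        rw [List.append_nil]
        refine lt_of_lt_of_le ?_ (hdiam g)
        calc r ≤ ρ * (A * S.wordNorm g) := mul_le_mul_of_nonneg_left h1 hρ0.le
          _ = b * S.wordNorm g / 2 := by rw [hρ]; field_simp
          _ < b * S.wordNorm g := half_lt_self (by positivity))
      ⟨m, hlen⟩
    refine ⟨w ++ [i], by simpa using hlen w hP, hx,
      g ++ (w ++ [i]), by simp, not_lt.1 hP', ?_, ?_, rfl⟩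
    · rwa [← List.append_assoc, List.dropLast_concat]
    · obtain ⟨y, hy, hyx⟩ := hx
      refine ⟨S.wordMap g x₁, ⟨y, hy, by rw [S.wordMap_append_apply, hyx]⟩, ?_⟩
      rw [Metric.mem_closedBall, dist_eq_norm]
      exact h3 x₁ hx₁
  have hPhi := hM (S.wordMap g₀ x₁) (hF.mapsTo g₀ hx₁) r hr0
  have hPhifin : (S.Phi F (S.wordMap g₀ x₁) r).Finite := Set.finite_of_encard_le_coe hPhi
  choose! l hlm hlx hlPhi using hext
  have hle : T.card ≤ (hPhifin.toFinset ×ˢ hfin.toFinset).card := by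
    refine Finset.card_le_card_of_injOn (fun g => (F.domRestrict (S.wordMap (g ++ l g)), l g))
      (fun g hg => ?_) fun g hg g' hg' heq => ?_
    · simpa using ⟨hlPhi g hg, hlm g hg⟩
    -- With equal suffixes, equality of the extended maps would make `φ_g` and `φ_g'` agree on the
    -- image of `F` under the suffix, but they differ everywhere on `F`.
    · by_contra hne
      obtain ⟨heq1, heq2⟩ := Prod.mk.inj heq
      obtain ⟨y, hy, -⟩ := hlx g hg
      have h1 : S.wordMap (g ++ l g) y = S.wordMap (g' ++ l g') y := congrFun heq1 ⟨y, hy⟩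
      rw [← heq2, S.wordMap_append_apply, S.wordMap_append_apply] at h1
      exact hsep g hg g' hg' hne _ (hF.mapsTo (l g) hy) h1
  rw [Finset.card_product, hcard] at hle
  have hPc : hPhifin.toFinset.card ≤ M := by
    rw [hPhifin.encard_eq_coe_toFinset_card] at hPhi
    exact_mod_cast hPhi
  have := Nat.mul_le_mul_right hfin.toFinset.card hPc
  omega

/-- Total boundedness of the rescaled maps: each is coded by its approximate values on a finite net
of `F`, and by the criterion the code is injective. -/
theorem IsSelfConformalSet.weakSeparation_of_identityLimitCriterion [Nontrivial (E d)]
    (hF : S.IsSelfConformalSet F) (hF2 : F.Nontrivial) (hI : S.IdentityLimitCriterion F) :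
    S.WeakSeparation F := by
  have hpos := S.wordNorm_pos hF.nonempty_domain
  obtain ⟨c, hc, hsep⟩ := hI
  obtain ⟨b, hb, hdiam⟩ := hF.exists_le_diam_image hF2
  obtain ⟨D, hD0, hD⟩ := hF.exists_norm_sub_le
  obtain ⟨C, hC, hCw⟩ := hF.exists_wordNorm_le_append_singleton
  have hFne := hF.nonempty.to_subtype
  -- Since `r ≤ D * C * ‖φ_w'‖`, a distance `σ / 4 * r` is at most a quarter of the separation
  -- `c‖φ_w'‖`.
  set σ : ℝ := c / (D * C) with hσ
  have hσ0 : 0 < σ := by positivity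
  obtain ⟨t, htF, htfin, ht⟩ :=
    hF.isCompact.finite_cover_balls (show 0 < b * σ / 16 by positivity)
  obtain ⟨s, -, hsfin, hs⟩ :=
    -- Radius `2` suffices because `φ_w(F)` has diameter at most `r` and meets `B(x,r)`.
    (isCompact_closedBall (0 : E d) 2).finite_cover_balls (show 0 < σ / 16 by positivity)
  have := htfin.to_subtype
  have := hsfin.to_subtype
  have : Nonempty s := by
    obtain ⟨p, hp, -⟩ := mem_iUnion₂.1 (hs (Metric.mem_closedBall_self two_pos.le))
    exact ⟨⟨p, hp⟩⟩
  refine ⟨Nat.card (t → s), fun x hx r hr => ?_⟩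
  have hword : ∀ g ∈ S.Phi F x r, ∃ w : List (Fin N), g = F.domRestrict (S.wordMap w) ∧
      b * S.wordNorm w ≤ r ∧ r ≤ D * C * S.wordNorm w ∧
      ∀ y ∈ F, ‖S.wordMap w y - x‖ ≤ 2 * r := by
    rintro g ⟨w, hw, hle, hlt, ⟨_, ⟨p, hp, rfl⟩, hpx⟩, hg⟩
    refine ⟨w, hg, (hdiam w).trans hle, ?_, fun y hy => ?_⟩
    · have h1 := hlt.le.trans (hF.diam_image_le hD0.le hD w.dropLast)
      have h2 := hCw w.dropLast (w.getLast hw)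
      rw [List.dropLast_append_getLast] at h2
      calc r ≤ S.wordNorm w.dropLast * D := h1
        _ ≤ C * S.wordNorm w * D := by gcongr
        _ = _ := by ring
    · have h1 := Metric.dist_le_diam_of_mem (hF.isBounded_image w) (mem_image_of_mem _ hy)
        (mem_image_of_mem _ hp)
      have h2 := dist_triangle (S.wordMap w y) (S.wordMap w p) x
      rw [← dist_eq_norm]
      linarith [Metric.mem_closedBall.1 hpx]
  choose! word hwg hwb hwr hwx using hword
  have hcode : ∀ g ∈ S.Phi F x r, ∀ y : t, ∃ p : s,
      ‖r⁻¹ • (S.wordMap (word g) y - x) - p‖ < σ / 16 := by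
    intro g hg y
    have hmem : r⁻¹ • (S.wordMap (word g) y - x) ∈ Metric.closedBall (0 : E d) 2 := by
      rw [mem_closedBall_zero_iff, norm_smul, norm_inv, Real.norm_of_nonneg hr.le,
        inv_mul_le_iff₀ hr, mul_comm]
      exact hwx g hg y (htF y.2)
    obtain ⟨p, hp, hlt⟩ := mem_iUnion₂.1 (hs hmem)
    exact ⟨⟨p, hp⟩, by simpa [dist_eq_norm] using hlt⟩
  choose! code hcode using hcode
  have hinj : InjOn code (S.Phi F x r) := by
    intro g hg g' hg' heq
    by_contra hne
    rw [hwg g hg, hwg g' hg'] at hne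
    have hlip : ∀ g ∈ S.Phi F x r, ∀ y ∈ F, ∀ y' ∈ F, ‖y - y'‖ ≤ b * σ / 16 →
        ‖S.wordMap (word g) y - S.wordMap (word g) y'‖ ≤ σ / 16 * r := by
      intro g hg y hy y' hy' hyy
      refine (S.norm_wordMap_sub_le _ (hF.subset hy) (hF.subset hy')).trans ?_
      have := hpos (word g)
      calc _ ≤ S.wordNorm (word g) * (b * σ / 16) := by gcongr
        _ = σ / 16 * (b * S.wordNorm (word g)) := by ring
        _ ≤ _ := by
          gcongr
          exact hwb g hg
    -- Moving to a net point costs `σ / 16` for each map and the common code costs `σ / 8`, in units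
    -- of `r`.
    have hnear : ∀ y : F, ‖S.wordMap (word g) y - S.wordMap (word g') y‖ ≤ σ / 4 * r := by
      rintro ⟨y, hy⟩
      obtain ⟨q, hq, hyq⟩ := mem_iUnion₂.1 (ht hy)
      have hyq' : ‖y - q‖ ≤ b * σ / 16 := by
        have : dist y q < b * σ / 16 := by simpa using hyq
        rw [← dist_eq_norm]
        exact this.le
      have h1 := hlip g hg y hy q (htF hq) hyq'
      have h2 := hlip g' hg' y hy q (htF hq) hyq'
      have h3 : ‖S.wordMap (word g) q - S.wordMap (word g') q‖ ≤ σ / 8 * r := by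
        have h4 := hcode g hg ⟨q, hq⟩
        have h5 := hcode g' hg' ⟨q, hq⟩
        rw [← heq] at h5
        have h6 := norm_sub_le
          (r⁻¹ • (S.wordMap (word g) q - x) - (code g ⟨q, hq⟩ : E d))
          (r⁻¹ • (S.wordMap (word g') q - x) - (code g ⟨q, hq⟩ : E d))
        rw [sub_sub_sub_cancel_right, ← smul_sub, sub_sub_sub_cancel_right, norm_smul, norm_inv,
          Real.norm_of_nonneg hr.le] at h6
        have h7 : r⁻¹ * ‖S.wordMap (word g) q - S.wordMap (word g') q‖ ≤ σ / 8 := by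
          simp only at h4 h5
          linarith
        rw [inv_mul_le_iff₀ hr] at h7
        linarith
      have h8 : S.wordMap (word g) y - S.wordMap (word g') y =
          (S.wordMap (word g) y - S.wordMap (word g) q) +
          (S.wordMap (word g) q - S.wordMap (word g') q) -
          (S.wordMap (word g') y - S.wordMap (word g') q) := by abel
      simp only
      rw [h8]
      have h9 := norm_sub_le ((S.wordMap (word g) y - S.wordMap (word g) q) +
          (S.wordMap (word g) q - S.wordMap (word g') q))
          (S.wordMap (word g') y - S.wordMap (word g') q)
      have h10 := norm_add_le (S.wordMap (word g) y - S.wordMap (word g) q)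
          (S.wordMap (word g) q - S.wordMap (word g') q)
      linarith
    have hbig : c ≤ (S.wordNorm (word g))⁻¹ * (σ / 4 * r) :=
      (hsep _ _ hne).trans (mul_le_mul_of_nonneg_left (ciSup_le hnear)
        (inv_nonneg.2 (hpos _).le))
    have hwpos := hpos (word g)
    rw [le_inv_mul_iff₀ hwpos] at hbig
    have h1 : σ / 4 * r ≤ c * S.wordNorm (word g) / 4 := by
      calc σ / 4 * r ≤ σ / 4 * (D * C * S.wordNorm (word g)) := by
            gcongr
            exact hwr g hg
        _ = _ := by rw [hσ]; field_simp
    have h2 : 0 < c * S.wordNorm (word g) := by positivity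
    linarith
  calc (S.Phi F x r).encard = (code '' S.Phi F x r).encard := hinj.encard_image.symm
    _ ≤ (univ : Set (t → s)).encard := encard_le_encard (subset_univ _)
    _ = Nat.card (t → s) := by rw [encard_univ, ENat.card_eq_coe_natCard]

end WeakSeparation
end ConformalIFS
end SelfConformal
end

theorem theorem3p2 (d N : ℕ) (S : SelfConformal.ConformalIFS d N)
    (F : Set (EuclideanSpace ℝ (Fin d))) (hF : S.IsSelfConformalSet F) (hF2 : F.Nontrivial) :
    S.WeakSeparation F ↔ S.IdentityLimitCriterion F := by
  -- Two points in `F` rule out `d = 0`.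
  have : Nontrivial (SelfConformal.E d) :=
    let ⟨x, _, y, _, hxy⟩ := hF2
    ⟨x, y, hxy⟩
  exact ⟨hF.identityLimitCriterion_of_weakSeparation hF2,
    hF.weakSeparation_of_identityLimitCriterion hF2⟩
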